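/- Let $\mathcal P$ be a simplicial tiling of $\mathbb R^d$ of finite local complexity: the tiles are $d$-simplices with ordered vertices which cover $\mathbb R^d$ and meet face to face, there are finitely many tiles up to translation, the orders agree on common faces, and tiles that are translates of each other have translated vertex orders. Let $\Omega_{\mathcal P}$ be its hull, i.e. the closure of the translation orbit $\{\mathcal P-x : x\in\mathbb R^d\}$ for the tiling metric $D(\mathcal P_1,\mathcal P_2)=\inf\{\frac1{r+1} : r>0,\ \exists x,y\in B_{1/r}(0)$ such that $\mathcal P_1-x$ and $\mathcal P_2-y$ coincide on $B_r(0)\}$ (with $D=1$ if there is no such $r$). Give every simplex (face of a tile) $\sigma$ a puncture $p_\sigma$ in its relative interior, so that translated simplices have translated punctures, and let $\Xi^n$ be the set of tilings in $\Omega_{\mathcal P}$ that have an $n$-simplex with puncture at $0$. Let $A$ be an abelian group. A simplicial $n$-cochain $c$ assigns to each $n$-simplex $\sigma$ of $\mathcal P$ a value $c(\sigma)\in A$, and $d_S c(\sigma)=\sum_i(-1)^i c(\partial_i\sigma)$. It is s-PE if for some $k$ the value $c(\sigma)$ depends only on the translation class of $\sigma$ together with its $k$-neighborhood (the tiles containing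 $\sigma$, enlarged $k$ times by all touching tiles). Let $\mathcal S_0^{n}$ be the finite set of $n$-simplices of $\mathcal P$ modulo the equivalence relation generated by identifying corresponding faces of translated tiles; for $\tilde\sigma\in\mathcal S_0^n$ let $\Xi(\tilde\sigma)\subset\Xi^n$ be the set of tilings whose $n$-simplex with puncture at $0$ corresponds to $\tilde\sigma$, and let $x_{\tilde\sigma,i}=p_{\partial_i\sigma}-p_\sigma$ for any representative $\sigma$. The PV differential takes $f:\Xi^n\to A$ to $$d_{PV}f(\xi)=\sum_{\tilde\sigma\in\mathcal S_0^{n+1}}\sum_{i=0}^{n+1}(-1)^i\,\mathbf 1_{\Xi(\tilde\sigma)}(\xi)\,f(\xi-x_{\tilde\sigma,i}).$$ (1) The s-PE cochains with $d_S$, and the locally constant functions on $\Xi^*$ with $d_{PV}$, are complexes. For every s-PE $n$-cochain $c$ there is exactly one locally constant function $\phi(c):\Xi^n\to A$ such that $\phi(c)(\mathcal P-p_\sigma)=c(\sigma)$ for all $n$-simplices $\sigma$ of $\mathcal P$, and $\phi$ is an isomorphism of complexes from the s-PE cochains onto the locally constant functions. It induces an isomorphism from the strong PE simplicial cohomology (that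 of the s-PE cochains) onto the strong PV cohomology (that of the locally constant functions), $[c]\mapsto[\phi(c)]$. (2) Suppose that $A$ is a topological group whose topology is given by a complete metric $\delta$, and let the w-PE cochains be the closure of the s-PE cochains in the bounded cochains for $\tilde\delta(c,c')=\sup_\sigma\delta(c(\sigma),c'(\sigma))$. The w-PE cochains with $d_S$, and the continuous functions on $\Xi^*$ with $d_{PV}$, are complexes. The map $\phi$ is isometric for the sup metrics, and extends to an isometric isomorphism of complexes from the w-PE cochains onto the continuous functions on $\Xi^*$, which sends $c$ to the unique continuous function $f$ with $f(\mathcal P-p_\sigma)=c(\sigma)$ for all $\sigma$. It induces an isomorphism from the weak PE simplicial cohomology (that of the w-PE cochains) onto the weak PV cohomology (that of the continuous functions), $[c]\mapsto[\phi(c)]$. -/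

import Mathlib

open scoped ENNReal

/-- The euclidean space `ℝ^d`. -/
abbrev Euc (d : ℕ) : Type := EuclideanSpace ℝ (Fin d)

/-- The translation `τ^x(s) = s - x` of a simplex `s`, given as the ordered list of its vertices. -/
def shift {d n : ℕ} (x : Euc d) (s : Fin n → Euc d) : Fin n → Euc d := fun i => s i - x

/-- The set covered by the simplex with vertices `s`. -/
def cell {d n : ℕ} (s : Fin n → Euc d) : Set (Euc d) := convexHull ℝ (Set.range s)

theorem shift_shift {d n : ℕ} (x y : Euc d) (s : Fin n → Euc d) :
    shift x (shift y s) = shift (y + x) s := by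
  funext i; simp [shift, sub_sub]

theorem shift_zero {d n : ℕ} (s : Fin n → Euc d) : shift 0 s = s := by
  funext i; simp [shift]

theorem shift_injective {d n : ℕ} (x : Euc d) :
    Function.Injective (shift x : (Fin n → Euc d) → (Fin n → Euc d)) := by
  intro s s' h
  funext i
  have := congrFun h i
  simpa [shift] using this

theorem range_shift {d n : ℕ} (x : Euc d) (s : Fin n → Euc d) :
    Set.range (shift x s) = (fun v => v - x) '' Set.range s := by
  rw [← Set.range_comp]; rfl

theorem cell_shift {d n : ℕ} (x : Euc d) (s : Fin n → Euc d) :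
    cell (shift x s) = (fun v => v - x) '' cell s := by
  have h := (AffineMap.image_convexHull
    ((AffineEquiv.constVAdd ℝ (Euc d) (-x)) : Euc d →ᵃ[ℝ] Euc d) (Set.range s)).symm
  have e : (((AffineEquiv.constVAdd ℝ (Euc d) (-x)) : Euc d →ᵃ[ℝ] Euc d) : Euc d → Euc d)
      = fun v => v - x := by
    funext v; simp [sub_eq_add_neg, add_comm]
  rw [e] at h
  rw [cell, cell, range_shift, h]

/-- A simplicial tiling of `ℝ^d` of finite local complexity. A tile is a `d`-simplex together with
the order of its vertices, so that its characteristic map is `∑ xᵢ eᵢ ↦ ∑ xᵢ t i`. -/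
structure SimplicialTiling (d : ℕ) where
  /-- the tiles, as ordered lists of vertices -/
  tiles : Set (Fin (d + 1) → Euc d)
  /-- the vertices of a tile are in general position -/
  affineIndependent : ∀ t ∈ tiles, AffineIndependent ℝ t
  /-- the tiles cover the space -/
  cover : ∀ v : Euc d, ∃ t ∈ tiles, v ∈ cell t
  /-- tiles meet face to face -/
  face_to_face : ∀ t ∈ tiles, ∀ t' ∈ tiles,
    cell t ∩ cell t' = convexHull ℝ (Set.range t ∩ Set.range t')
  /-- the orders of the vertices of two tiles agree on their common vertices -/
  order_compat : ∀ t ∈ tiles, ∀ t' ∈ tiles, ∀ i j i' j',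
    t i = t' i' → t j = t' j' → i < j → i' < j'
  /-- tiles that differ by a translation have characteristic maps that differ by it -/
  equivariant : ∀ t ∈ tiles, ∀ t' ∈ tiles, ∀ x : Euc d,
    Set.range t' = (fun v => v - x) '' Set.range t → t' = shift x t
  /-- there are only finitely many tiles up to translation -/
  finite_prototiles : ∃ F : Set (Fin (d + 1) → Euc d), F.Finite ∧
    ∀ t ∈ tiles, ∃ q ∈ F, ∃ x : Euc d, t = shift x q

/-- A choice of punctures: every simplex of `ℝ^d` (given by its vertex set) gets a point in its
relative interior, and translates of a simplex have their punctures at the same relative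
position. -/
structure Puncturing (d : ℕ) where
  /-- the puncture of the simplex with the given vertex set -/
  point : Set (Euc d) → Euc d
  /-- the puncture has positive barycentric coordinates -/
  interior : ∀ (n : ℕ) (s : Fin (n + 1) → Euc d), AffineIndependent ℝ s →
    ∃ w : Fin (n + 1) → ℝ, (∀ i, 0 < w i) ∧ ∑ i, w i = 1 ∧ point (Set.range s) = ∑ i, w i • s i
  /-- translates are punctured at the same relative position -/
  equivariant : ∀ (n : ℕ) (s : Fin (n + 1) → Euc d), AffineIndependent ℝ s → ∀ x : Euc d,
    point (Set.range (shift x s)) = point (Set.range s) - x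

/-- The puncture of the simplex `s`. -/
def Puncturing.pt {d n : ℕ} (p : Puncturing d) (s : Fin (n + 1) → Euc d) : Euc d :=
  p.point (Set.range s)

namespace SimplicialTiling

variable {d : ℕ}

@[ext]
theorem ext' {P Q : SimplicialTiling d} (h : P.tiles = Q.tiles) : P = Q := by
  cases P; cases Q; cases h; rfl

/-! ### Translations, the tiling metric and the hull -/

theorem image_sub_inter (x : Euc d) (S T : Set (Euc d)) :
    (fun v => v - x) '' S ∩ (fun v => v - x) '' T = (fun v => v - x) '' (S ∩ T) :=
  (Set.image_inter (sub_left_injective)).symm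

theorem image_sub_convexHull (x : Euc d) (S : Set (Euc d)) :
    convexHull ℝ ((fun v => v - x) '' S) = (fun v => v - x) '' convexHull ℝ S := by
  have h := (AffineMap.image_convexHull
    ((AffineEquiv.constVAdd ℝ (Euc d) (-x)) : Euc d →ᵃ[ℝ] Euc d) S).symm
  have e : (((AffineEquiv.constVAdd ℝ (Euc d) (-x)) : Euc d →ᵃ[ℝ] Euc d) : Euc d → Euc d)
      = fun v => v - x := by
    funext v; simp [sub_eq_add_neg, add_comm]
  rwa [e] at h

theorem affineIndependent_shift {n : ℕ} (x : Euc d) {s : Fin n → Euc d}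
    (h : AffineIndependent ℝ s) : AffineIndependent ℝ (shift x s) := by
  have h' := (AffineEquiv.affineIndependent_iff (AffineEquiv.constVAdd ℝ (Euc d) (-x))
    (p := s)).2 h
  have e : (AffineEquiv.constVAdd ℝ (Euc d) (-x)) ∘ s = shift x s := by
    funext i; simp [shift, sub_eq_add_neg, add_comm]
  rwa [e] at h'

/-- The translate `τ^x(P) = P - x`. -/
def translate (x : Euc d) (P : SimplicialTiling d) : SimplicialTiling d where
  tiles := shift x '' P.tiles
  affineIndependent := by
    rintro _ ⟨t, ht, rfl⟩
    exact affineIndependent_shift x (P.affineIndependent t ht)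
  cover := by
    intro v
    obtain ⟨t, ht, hv⟩ := P.cover (v + x)
    refine ⟨_, ⟨t, ht, rfl⟩, ?_⟩
    rw [cell_shift]
    exact ⟨v + x, hv, by simp⟩
  face_to_face := by
    rintro _ ⟨t, ht, rfl⟩ _ ⟨t', ht', rfl⟩
    rw [cell_shift, cell_shift, range_shift, range_shift, image_sub_inter, image_sub_inter,
      image_sub_convexHull, P.face_to_face t ht t' ht']
  order_compat := by
    rintro _ ⟨t, ht, rfl⟩ _ ⟨t', ht', rfl⟩ i j i' j' hi hj
    exact P.order_compat t ht t' ht' i j i' j' (by simpa [shift] using hi)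
      (by simpa [shift] using hj)
  equivariant := by
    rintro _ ⟨t, ht, rfl⟩ _ ⟨t', ht', rfl⟩ y h
    have h2 : Set.range t' = (fun v => v - y) '' Set.range t := by
      rw [range_shift, range_shift, Set.image_image] at h
      have h3 := congrArg (fun S => (fun v => v + x) '' S) h
      simp only [Set.image_image, sub_add_cancel, Set.image_id'] at h3
      rw [h3]
      congr 1
      funext v
      abel
    rw [P.equivariant t ht t' ht' y h2, shift_shift, shift_shift, add_comm y x]
  finite_prototiles := by
    obtain ⟨F, hF, h⟩ := P.finite_prototiles
    refine ⟨F, hF, ?_⟩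
    rintro _ ⟨t, ht, rfl⟩
    obtain ⟨q, hq, y, rfl⟩ := h t ht
    exact ⟨q, hq, y + x, shift_shift _ _ _⟩

theorem translate_translate (x y : Euc d) (P : SimplicialTiling d) :
    translate x (translate y P) = translate (y + x) P := by
  apply ext'
  simp only [translate, Set.image_image, shift_shift]

theorem translate_comm (x y : Euc d) (P : SimplicialTiling d) :
    translate x (translate y P) = translate y (translate x P) := by
  rw [translate_translate, translate_translate, add_comm]

/-- The tiles that meet the `r`-ball around `0`. Two tilings coincide on that ball,
`B_r[P] = B_r[Q]`, if `P.patch r = Q.patch r`. -/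
def patch (P : SimplicialTiling d) (r : ℝ) : Set (Fin (d + 1) → Euc d) :=
  {t | t ∈ P.tiles ∧ (cell t ∩ Metric.ball 0 r).Nonempty}

/-- The tiling metric `D`; the infimum over an empty set of radii is read as `1`, which bounds
all the values `1 / (r + 1)`. -/
noncomputable def tilingDist (P Q : SimplicialTiling d) : ℝ :=
  sInf (insert 1 {e : ℝ | ∃ r : ℝ, 0 < r ∧ e = 1 / (r + 1) ∧
    ∃ x ∈ Metric.ball (0 : Euc d) (1 / r), ∃ y ∈ Metric.ball (0 : Euc d) (1 / r),
      (translate x P).patch r = (translate y Q).patch r})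

/-- The topology given by `D`. -/
instance : TopologicalSpace (SimplicialTiling d) where
  IsOpen U := ∀ P ∈ U, ∃ ε : ℝ, 0 < ε ∧ ∀ Q, tilingDist P Q < ε → Q ∈ U
  isOpen_univ := fun _ _ => ⟨1, one_pos, fun _ _ => trivial⟩
  isOpen_inter := by
    rintro U V hU hV P ⟨hPU, hPV⟩
    obtain ⟨ε, hε, h⟩ := hU P hPU
    obtain ⟨ε', hε', h'⟩ := hV P hPV
    exact ⟨min ε ε', lt_min hε hε', fun Q hQ =>
      ⟨h Q (hQ.trans_le (min_le_left _ _)), h' Q (hQ.trans_le (min_le_right _ _))⟩⟩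
  isOpen_sUnion := by
    rintro S hS P ⟨U, hU, hP⟩
    obtain ⟨ε, hε, h⟩ := hS U hU P hP
    exact ⟨ε, hε, fun Q hQ => ⟨U, hU, h Q hQ⟩⟩

/-- The tiling space `Ω_P`: the closure of the translation orbit of `P`. -/
def hull (P : SimplicialTiling d) : Set (SimplicialTiling d) :=
  closure (Set.range fun x : Euc d => translate x P)

theorem patch_translate {P Q : SimplicialTiling d} {r R : ℝ} {x : Euc d}
    (h : P.patch r = Q.patch r) (hR : R + ‖x‖ ≤ r) :
    (translate x P).patch R = (translate x Q).patch R := by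
  have key : ∀ P Q : SimplicialTiling d, P.patch r = Q.patch r →
      (translate x P).patch R ⊆ (translate x Q).patch R := by
    rintro P Q h _ ⟨⟨t, ht, rfl⟩, hne⟩
    refine ⟨?_, hne⟩
    obtain ⟨_, hv, hv'⟩ := hne
    rw [cell_shift] at hv
    obtain ⟨v, hv, rfl⟩ := hv
    have : t ∈ P.patch r := by
      refine ⟨ht, v, hv, ?_⟩
      rw [mem_ball_zero_iff] at hv' ⊢
      have := norm_add_le (v - x) x
      rw [sub_add_cancel] at this
      linarith
    rw [h] at this
    exact ⟨t, this.1, rfl⟩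
  exact (key P Q h).antisymm (key Q P h.symm)

theorem continuous_translate (x : Euc d) :
    Continuous (translate x : SimplicialTiling d → SimplicialTiling d) := by
  refine ⟨fun U hU P hP => ?_⟩
  obtain ⟨ε, hε, h⟩ := hU _ hP
  obtain ⟨R, hR0, hR⟩ : ∃ R : ℝ, 0 < R ∧ 1 / (R + 1) < ε := by
    refine ⟨1 / ε, by positivity, ?_⟩
    rw [div_lt_iff₀ (by positivity)]
    have : ε * (1 / ε) = 1 := by field_simp
    nlinarith
  have hx := norm_nonneg x
  refine ⟨1 / (R + ‖x‖ + 1), by positivity, fun Q hQ => h _ ?_⟩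
  have hne : (insert (1 : ℝ) {e : ℝ | ∃ r : ℝ, 0 < r ∧ e = 1 / (r + 1) ∧
    ∃ x ∈ Metric.ball (0 : Euc d) (1 / r), ∃ y ∈ Metric.ball (0 : Euc d) (1 / r),
      (translate x P).patch r = (translate y Q).patch r}).Nonempty := ⟨1, Set.mem_insert _ _⟩
  obtain ⟨e, he, hlt⟩ := exists_lt_of_csInf_lt hne hQ
  rcases he with rfl | ⟨r, hr, rfl, a, ha, b, hb, hab⟩
  · exfalso
    rw [lt_div_iff₀ (by positivity)] at hlt
    linarith
  have hr' : R + ‖x‖ < r := by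
    rw [div_lt_div_iff₀ (by positivity) (by positivity)] at hlt
    linarith
  have hle : 1 / r ≤ 1 / R := one_div_le_one_div_of_le hR0 (by linarith)
  refine lt_of_le_of_lt (csInf_le ?_ (Set.mem_insert_of_mem _ ⟨R, hR0, rfl,
    a, Metric.ball_subset_ball hle ha, b, Metric.ball_subset_ball hle hb, ?_⟩)) hR
  · refine ⟨0, ?_⟩
    rintro e (rfl | ⟨r, hr, rfl, -⟩)
    · exact zero_le_one
    · positivity
  · rw [translate_comm a, translate_comm b]
    exact patch_translate hab hr'.le

theorem translate_mem_hull {P Q : SimplicialTiling d} (x : Euc d) (hQ : Q ∈ P.hull) :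
    translate x Q ∈ P.hull := by
  refine map_mem_closure (continuous_translate x) hQ ?_
  rintro _ ⟨y, rfl⟩
  exact ⟨y + x, (translate_translate x y P).symm⟩

theorem orbit_mem_hull (P : SimplicialTiling d) (x : Euc d) : translate x P ∈ P.hull :=
  subset_closure ⟨x, rfl⟩

/-! ### Simplices, punctures and the `Δ`-transversal -/

/-- The `n`-simplices of the tiling: the `n`-dimensional faces of its tiles, with the induced order
of their vertices. -/
def simplices (P : SimplicialTiling d) (n : ℕ) : Set (Fin (n + 1) → Euc d) :=
  {s | ∃ t ∈ P.tiles, ∃ f : Fin (n + 1) ↪o Fin (d + 1), s = t ∘ f}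

theorem simplices_affineIndependent {P : SimplicialTiling d} {n : ℕ} {s : Fin (n + 1) → Euc d}
    (hs : s ∈ P.simplices n) : AffineIndependent ℝ s := by
  obtain ⟨t, ht, f, rfl⟩ := hs
  exact (P.affineIndependent t ht).comp_embedding f.toEmbedding

theorem shift_mem_simplices {P : SimplicialTiling d} {n : ℕ} {s : Fin (n + 1) → Euc d} (x : Euc d)
    (hs : s ∈ P.simplices n) : shift x s ∈ (translate x P).simplices n := by
  obtain ⟨t, ht, f, rfl⟩ := hs
  exact ⟨_, ⟨t, ht, rfl⟩, f, rfl⟩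

theorem comp_succAbove_mem {P : SimplicialTiling d} {n : ℕ} {s : Fin (n + 2) → Euc d}
    (i : Fin (n + 2)) (hs : s ∈ P.simplices (n + 1)) : s ∘ i.succAbove ∈ P.simplices n := by
  obtain ⟨t, ht, f, rfl⟩ := hs
  exact ⟨t, ht, (Fin.succAboveOrderEmb i).trans f, rfl⟩

/-- The `i`th face `∂ᵢσ`. -/
def face {P : SimplicialTiling d} {n : ℕ} (i : Fin (n + 2)) (σ : P.simplices (n + 1)) :
    P.simplices n :=
  ⟨σ.1 ∘ i.succAbove, comp_succAbove_mem i σ.2⟩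

/-- The set of punctures of all `n`-simplices of the tiling. -/
def punctures (P : SimplicialTiling d) (p : Puncturing d) (n : ℕ) : Set (Euc d) :=
  {v | ∃ s ∈ P.simplices n, p.pt s = v}

/-- The `n`-dimensional `Δ`-transversal `Ξⁿ`. -/
def transversal (P : SimplicialTiling d) (p : Puncturing d) (n : ℕ) : Set (SimplicialTiling d) :=
  {Q | Q ∈ P.hull ∧ (0 : Euc d) ∈ Q.punctures p n}

/-- The point `P - p_σ` of `Ξⁿ`, for an `n`-simplex `σ` of `P`. -/
def orbitPoint (P : SimplicialTiling d) (p : Puncturing d) {n : ℕ} (σ : P.simplices n) :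
    P.transversal p n :=
  ⟨translate (p.pt σ.1) P, P.orbit_mem_hull _, shift (p.pt σ.1) σ.1, shift_mem_simplices _ σ.2, by
    have := p.equivariant n σ.1 (simplices_affineIndependent σ.2) (p.pt σ.1)
    simpa [Puncturing.pt] using this⟩

/-! ### The simplices of `Γ₀` and their acceptance zones -/

/-- Two simplices of `P` are related if they are the same face of two tiles of the same
prototile. -/
def ProtoRel (P : SimplicialTiling d) (n : ℕ) (σ σ' : P.simplices n) : Prop :=
  ∃ t ∈ P.tiles, ∃ x : Euc d, shift x t ∈ P.tiles ∧
    ∃ f : Fin (n + 1) ↪o Fin (d + 1), σ.1 = t ∘ f ∧ σ'.1 = shift x t ∘ f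

/-- The set `S₀ⁿ` of `n`-simplices of `Γ₀`: the simplices of `P` up to the equivalence relation
generated by `ProtoRel`. (Faces of two tiles that coincide in `P` are the same simplex of `P`.) -/
def ProtoSimplex (P : SimplicialTiling d) (n : ℕ) : Type := Quot (P.ProtoRel n)

theorem exists_shift_of_mk_eq {P : SimplicialTiling d} {n : ℕ} {σ σ' : P.simplices n}
    (h : Quot.mk (P.ProtoRel n) σ = Quot.mk _ σ') : ∃ x, σ'.1 = shift x σ.1 := by
  have h' := Quot.eqvGen_exact h
  induction h' with
  | rel a b hab =>
    obtain ⟨t, -, x, -, f, ha, hb⟩ := hab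
    exact ⟨x, by rw [ha, hb]; rfl⟩
  | refl a => exact ⟨0, (shift_zero _).symm⟩
  | symm a b _ ih =>
    obtain ⟨x, hx⟩ := ih (Quot.eqvGen_sound ‹_›)
    exact ⟨-x, by rw [hx, shift_shift, add_neg_cancel, shift_zero]⟩
  | trans a b c _ _ ih ih' =>
    obtain ⟨x, hx⟩ := ih (Quot.eqvGen_sound ‹_›)
    obtain ⟨y, hy⟩ := ih' (Quot.eqvGen_sound ‹_›)
    exact ⟨x + y, by rw [hy, hx, shift_shift]⟩

instance (P : SimplicialTiling d) (n : ℕ) : Finite (P.ProtoSimplex n) := by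
  classical
  obtain ⟨F, hF, hFt⟩ := P.finite_prototiles
  have : Finite F := hF
  by_cases hne : Nonempty (P.ProtoSimplex n)
  swap
  · rw [not_nonempty_iff] at hne
    infer_instance
  let g : F × (Fin (n + 1) ↪o Fin (d + 1)) → P.ProtoSimplex n := fun a =>
    if h : ∃ x, shift x a.1.1 ∈ P.tiles then
      Quot.mk _ ⟨shift h.choose a.1.1 ∘ a.2, _, h.choose_spec, a.2, rfl⟩
    else hne.some
  have : Finite (Fin (n + 1) ↪o Fin (d + 1)) :=
    Finite.of_injective (fun f => (f : Fin (n + 1) → Fin (d + 1))) DFunLike.coe_injective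
  refine Finite.of_surjective g ?_
  rintro ⟨⟨s, t, ht, f, hs⟩⟩
  obtain ⟨q, hq, x, hx⟩ := hFt t ht
  have hex : ∃ x, shift x q ∈ P.tiles := ⟨x, hx ▸ ht⟩
  refine ⟨(⟨q, hq⟩, f), ?_⟩
  refine (dif_pos hex).trans (Quot.sound ⟨_, hex.choose_spec, x - hex.choose, ?_, f, rfl, ?_⟩)
  · rw [shift_shift, add_sub_cancel, ← hx]; exact ht
  · rw [shift_shift, add_sub_cancel, ← hx]; exact hs

/-- The acceptance zone `Ξ(σ̃)`: the tilings of the hull that have, with its puncture on `0`, a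
simplex which corresponds to `σ̃`. -/
def acceptanceZone (P : SimplicialTiling d) (p : Puncturing d) {n : ℕ} (τ : P.ProtoSimplex n) :
    Set (SimplicialTiling d) :=
  {Q | Q ∈ P.hull ∧ ∃ t ∈ Q.tiles, ∃ f : Fin (n + 1) ↪o Fin (d + 1), p.pt (t ∘ f) = 0 ∧
    ∃ x : Euc d, ∃ h : shift x t ∈ P.tiles, Quot.mk _ ⟨shift x t ∘ f, _, h, f, rfl⟩ = τ}

/-- The vector `x_{σ̃,i}` from the puncture of a simplex to the puncture of its `i`th face. -/
noncomputable def faceVector (P : SimplicialTiling d) (p : Puncturing d) {n : ℕ}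
    (τ : P.ProtoSimplex (n + 1)) (i : Fin (n + 2)) : Euc d :=
  p.pt (face i (Quot.out τ)).1 - p.pt (Quot.out τ).1

theorem translate_mem_transversal {P : SimplicialTiling d} {p : Puncturing d} {n : ℕ}
    {τ : P.ProtoSimplex (n + 1)} {Q : SimplicialTiling d} (i : Fin (n + 2))
    (hQ : Q ∈ P.acceptanceZone p τ) :
    translate (P.faceVector p τ i) Q ∈ P.transversal p n := by
  obtain ⟨hQ, t, ht, f, h0, x, hx, hτ⟩ := hQ
  refine ⟨translate_mem_hull _ hQ, ?_⟩
  have hs : t ∘ f ∈ Q.simplices (n + 1) := ⟨t, ht, f, rfl⟩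
  obtain ⟨y, hy⟩ := exists_shift_of_mk_eq (hτ.trans (Quot.out_eq τ).symm)
  have hy' : (Quot.out τ).1 = shift (x + y) (t ∘ f) := by
    rw [hy]; funext j; simp [shift, sub_sub]
  have hA := simplices_affineIndependent hs
  have hB := simplices_affineIndependent (comp_succAbove_mem i hs)
  refine ⟨_, shift_mem_simplices _ (comp_succAbove_mem i hs), ?_⟩
  have e1 : p.pt (Quot.out τ).1 = p.pt (t ∘ f) - (x + y) := by
    rw [hy']; exact p.equivariant _ _ hA _
  have e2 : p.pt (face i (Quot.out τ)).1 = p.pt ((t ∘ f) ∘ i.succAbove) - (x + y) := by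
    have : (face i (Quot.out τ)).1 = shift (x + y) ((t ∘ f) ∘ i.succAbove) := by
      simp only [face, hy']; rfl
    rw [this]; exact p.equivariant _ _ hB _
  have e3 := p.equivariant _ _ hB (P.faceVector p τ i)
  change p.pt _ = p.pt _ - _ at e3
  rw [e3, faceVector, e1, e2, h0]
  abel

/-! ### PV cochains -/

variable {A : Type*} [AddCommGroup A]

open Classical in
/-- The map `θ_{σ̃,i}`: pull back along the partial translation by `x_{σ̃,i}`, extended by zero
outside the acceptance zone of `σ̃`. -/
noncomputable def theta (P : SimplicialTiling d) (p : Puncturing d) {n : ℕ}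
    (τ : P.ProtoSimplex (n + 1)) (i : Fin (n + 2)) :
    (P.transversal p n → A) →+ (P.transversal p (n + 1) → A) where
  toFun f ξ := if h : ξ.1 ∈ P.acceptanceZone p τ then
    f ⟨translate (P.faceVector p τ i) ξ.1, translate_mem_transversal i h⟩ else 0
  map_zero' := by funext ξ; simp
  map_add' f g := by
    funext ξ
    by_cases h : ξ.1 ∈ P.acceptanceZone p τ <;> simp [h]

/-- The PV differential `d_PV = ∑_{σ̃} ∑ᵢ (-1)ⁱ θ_{σ̃,i}`. -/
noncomputable def dPV (A : Type*) [AddCommGroup A] (P : SimplicialTiling d) (p : Puncturing d)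
    (n : ℕ) : (P.transversal p n → A) →+ (P.transversal p (n + 1) → A) :=
  letI := Fintype.ofFinite (P.ProtoSimplex (n + 1))
  ∑ τ : P.ProtoSimplex (n + 1), ∑ i : Fin (n + 2), ((-1 : ℤ) ^ (i : ℕ)) • P.theta p τ i

/-- The strong PV cochains: locally constant functions on `Ξⁿ`. -/
def strongPV (A : Type*) [AddCommGroup A] (P : SimplicialTiling d) (p : Puncturing d) (n : ℕ) :
    AddSubgroup (P.transversal p n → A) where
  carrier := {f | IsLocallyConstant f}
  zero_mem' := IsLocallyConstant.const 0
  add_mem' hf hg := IsLocallyConstant.add hf hg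
  neg_mem' hf := IsLocallyConstant.neg hf

/-- The weak PV cochains: continuous functions on `Ξⁿ`. -/
def weakPV (A : Type*) [AddCommGroup A] [TopologicalSpace A] [IsTopologicalAddGroup A]
    (P : SimplicialTiling d) (p : Puncturing d) (n : ℕ) :
    AddSubgroup (P.transversal p n → A) where
  carrier := {f | Continuous f}
  zero_mem' := continuous_const
  add_mem' hf hg := Continuous.add hf hg
  neg_mem' hf := Continuous.neg hf

/-! ### Pattern equivariant simplicial cochains -/

/-- The simplicial coboundary `d_S` on all cochains `P.simplices n → A`
(homomorphisms from the free group on the simplices). -/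
def dS (A : Type*) [AddCommGroup A] (P : SimplicialTiling d) (n : ℕ) :
    (P.simplices n → A) →+ (P.simplices (n + 1) → A) where
  toFun c σ := ∑ i : Fin (n + 2), ((-1 : ℤ) ^ (i : ℕ)) • c (face i σ)
  map_zero' := by funext σ; simp
  map_add' c c' := by funext σ; simp [Finset.sum_add_distrib]

/-- The tiles of the `k`-neighborhood of a simplex: for `k = 0` the tiles of which it is a face (so
only the simplex itself if it is a tile), then successively all the tiles that touch. -/
def neighborhood (P : SimplicialTiling d) {n : ℕ} (s : Fin (n + 1) → Euc d) :
    ℕ → Set (Fin (d + 1) → Euc d)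
  | 0 => {t | t ∈ P.tiles ∧ Set.range s ⊆ Set.range t}
  | k + 1 => {t | t ∈ P.tiles ∧ ∃ u ∈ neighborhood P s k, (cell t ∩ cell u).Nonempty}

/-- Two simplices of `P` agree, together with their `k`-neighborhoods, up to a translation. -/
def SameNeighborhood (P : SimplicialTiling d) (k : ℕ) {n : ℕ} (σ σ' : P.simplices n) : Prop :=
  ∃ x : Euc d, σ'.1 = shift x σ.1 ∧
    ∀ j ≤ k, P.neighborhood σ'.1 j = shift x '' P.neighborhood σ.1 j

/-- The s-PE cochains: for some `k` the value on a simplex depends only on the `k`-neighborhood of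
the simplex. -/
def strongPE (A : Type*) [AddCommGroup A] (P : SimplicialTiling d) (n : ℕ) :
    AddSubgroup (P.simplices n → A) where
  carrier := {c | ∃ k : ℕ, ∀ σ σ', P.SameNeighborhood k σ σ' → c σ = c σ'}
  zero_mem' := ⟨0, fun _ _ _ => rfl⟩
  add_mem' := by
    rintro c c' ⟨k, h⟩ ⟨k', h'⟩
    refine ⟨max k k', fun σ σ' ⟨x, hx, hj⟩ => ?_⟩
    rw [Pi.add_apply, Pi.add_apply, h σ σ' ⟨x, hx, fun j hjk => hj j (le_max_of_le_left hjk)⟩,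
      h' σ σ' ⟨x, hx, fun j hjk => hj j (le_max_of_le_right hjk)⟩]
  neg_mem' := by
    rintro c ⟨k, h⟩
    exact ⟨k, fun σ σ' hs => by rw [Pi.neg_apply, Pi.neg_apply, h σ σ' hs]⟩

theorem neighborhood_finite (P : SimplicialTiling d) (k : ℕ) :
    ∃ G : Set (Fin (d + 1) → Euc d), G.Finite ∧ ∀ (n : ℕ) (s : Fin (n + 1) → Euc d),
      shift (s 0) '' P.neighborhood s k ⊆ G := by
  obtain ⟨F, hF, hFt⟩ := P.finite_prototiles
  induction k with
  | zero =>
    refine ⟨⋃ i : Fin (d + 1), (fun q => shift (q i) q) '' F,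
      Set.finite_iUnion fun i => hF.image _, ?_⟩
    rintro n s _ ⟨t, ⟨ht, hst⟩, rfl⟩
    obtain ⟨i, hi⟩ := hst ⟨0, rfl⟩
    obtain ⟨q, hq, x, rfl⟩ := hFt t ht
    refine Set.mem_iUnion.2 ⟨i, q, hq, ?_⟩
    rw [← hi, shift_shift]
    simp [shift]
  | succ k ih =>
    obtain ⟨G, hG, h⟩ := ih
    refine ⟨⋃ i : Fin (d + 1), ⋃ l : Fin (d + 1),
      Set.image2 (fun u q => shift (q i - u l) q) G F,
      Set.finite_iUnion fun i => Set.finite_iUnion fun l => hG.image2 _ hF, ?_⟩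
    rintro n s _ ⟨t, ⟨ht, u, hu, hne⟩, rfl⟩
    have huP : u ∈ P.tiles := by cases k <;> exact hu.1
    rw [P.face_to_face t ht u huP, convexHull_nonempty_iff] at hne
    obtain ⟨v, ⟨i, hi⟩, ⟨l, hl⟩⟩ := hne
    obtain ⟨q, hq, x, rfl⟩ := hFt t ht
    refine Set.mem_iUnion.2 ⟨i, Set.mem_iUnion.2 ⟨l, _, h n s ⟨u, hu, rfl⟩, q, hq, ?_⟩⟩
    dsimp only
    rw [shift_shift]
    congr 1
    have e : q i - x = u l := hi.trans hl.symm
    have e' : shift (s 0) u l = u l - s 0 := rfl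
    rw [e', ← e]
    abel

theorem strongPE_finite_range {P : SimplicialTiling d} {n : ℕ} {c : P.simplices n → A}
    (hc : c ∈ P.strongPE A n) : (Set.range c).Finite := by
  obtain ⟨k, hk⟩ := hc
  obtain ⟨F, hF, hFt⟩ := P.finite_prototiles
  choose G hG hGs using P.neighborhood_finite
  let N : P.simplices n → (Fin (n + 1) → Euc d) × (Fin (k + 1) → Set (Fin (d + 1) → Euc d)) :=
    fun σ => (shift (σ.1 0) σ.1, fun j => shift (σ.1 0) '' P.neighborhood σ.1 j)
  have : Finite (Fin (n + 1) ↪o Fin (d + 1)) :=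
    Finite.of_injective (fun f => (f : Fin (n + 1) → Fin (d + 1))) DFunLike.coe_injective
  have hN : (Set.range N).Finite := by
    refine Set.Finite.subset (Set.Finite.prod
      (s := ⋃ f : Fin (n + 1) ↪o Fin (d + 1), (fun q => shift (q (f 0)) (q ∘ f)) '' F)
      (t := Set.pi Set.univ fun j : Fin (k + 1) => 𝒫 (G j))
      (Set.finite_iUnion fun f => hF.image _) (Set.Finite.pi fun j => (hG j).powerset)) ?_
    rintro _ ⟨⟨s, t, ht, f, rfl⟩, rfl⟩
    refine ⟨?_, fun j _ => hGs j n _⟩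
    obtain ⟨q, hq, x, rfl⟩ := hFt t ht
    refine Set.mem_iUnion.2 ⟨f, q, hq, ?_⟩
    funext j
    simp [N, shift]
  have hfac : ∀ σ σ', N σ = N σ' → c σ = c σ' := by
    intro σ σ' h
    obtain ⟨h1, h2⟩ := Prod.ext_iff.1 h
    refine hk σ σ' ⟨σ.1 0 - σ'.1 0, ?_, fun j hj => ?_⟩
    · have := congrArg (shift (-(σ'.1 0))) h1
      simp only [N, shift_shift, add_neg_cancel, shift_zero] at this
      rw [sub_eq_add_neg]; exact this.symm
    · have := congrArg (fun S => shift (-(σ'.1 0)) '' S) (congrFun h2 ⟨j, Nat.lt_succ_of_le hj⟩)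
      simp only [N, Set.image_image, shift_shift, add_neg_cancel, shift_zero, Set.image_id']
        at this
      rw [sub_eq_add_neg]; exact this.symm
  refine (hN.image (Function.extend N c 0)).subset ?_
  rintro _ ⟨σ, rfl⟩
  exact ⟨N σ, ⟨σ, rfl⟩, Function.FactorsThrough.extend_apply (fun σ σ' => hfac σ σ') 0 σ⟩

end SimplicialTiling

/-- The metric of uniform convergence, `sup_x δ(f(x), g(x))`, with values in `[0, ∞]`. -/
noncomputable def supEDist {X A : Type*} [PseudoEMetricSpace A] (f g : X → A) : ℝ≥0∞ :=
  ⨆ x, edist (f x) (g x)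

namespace SimplicialTiling

variable {d : ℕ}

/-- The condition that `c` lies in the closure of the s-PE cochains in the bounded cochains. -/
def IsWeakPE {A : Type*} [AddCommGroup A] [MetricSpace A] (P : SimplicialTiling d) {n : ℕ}
    (c : P.simplices n → A) : Prop :=
  Bornology.IsBounded (Set.range c) ∧
    ∀ ε : ℝ≥0∞, 0 < ε → ∃ c' ∈ P.strongPE A n, supEDist c c' < ε

section WeakPE

variable {A : Type*} [AddCommGroup A] [MetricSpace A] [CompleteSpace A]

theorem IsWeakPE.isCompact {P : SimplicialTiling d} {n : ℕ} {c : P.simplices n → A}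
    (hc : P.IsWeakPE c) : IsCompact (closure (Set.range c)) := by
  refine TotallyBounded.isCompact_of_isClosed (TotallyBounded.closure ?_) isClosed_closure
  rw [EMetric.totallyBounded_iff]
  intro ε hε
  obtain ⟨c', hc', h⟩ := hc.2 ε hε
  refine ⟨Set.range c', strongPE_finite_range hc', ?_⟩
  rintro _ ⟨σ, rfl⟩
  exact Set.mem_iUnion₂.2 ⟨c' σ, ⟨σ, rfl⟩,
    (le_iSup (fun σ => edist (c σ) (c' σ)) σ).trans_lt h⟩

/-- Continuous operations preserve w-PE cochains. -/
theorem IsWeakPE.map₂ {P : SimplicialTiling d} {n : ℕ} {c c' : P.simplices n → A}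
    (hc : P.IsWeakPE c) (hc' : P.IsWeakPE c') (m : A × A → A) (hm : Continuous m)
    (hs : ∀ b ∈ P.strongPE A n, ∀ b' ∈ P.strongPE A n,
      (fun σ => m (b σ, b' σ)) ∈ P.strongPE A n) :
    P.IsWeakPE fun σ => m (c σ, c' σ) := by
  have hK := hc.isCompact.prod hc'.isCompact
  refine ⟨((hK.image hm).isBounded).subset ?_, fun ε hε => ?_⟩
  · rintro _ ⟨σ, rfl⟩
    exact ⟨_, ⟨subset_closure ⟨σ, rfl⟩, subset_closure ⟨σ, rfl⟩⟩, rfl⟩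
  obtain ⟨ε', hε', hlt⟩ := exists_between hε
  have hu := hK.uniformContinuousAt_of_continuousAt m (fun a _ => hm.continuousAt)
    (edist_mem_uniformity hε')
  obtain ⟨δ, hδ, h⟩ := mem_uniformity_edist.1 hu
  obtain ⟨b, hb, hcb⟩ := hc.2 δ hδ
  obtain ⟨b', hb', hcb'⟩ := hc'.2 δ hδ
  refine ⟨_, hs b hb b' hb', lt_of_le_of_lt (iSup_le fun σ => ?_) hlt⟩
  have h1 : edist (c σ) (b σ) < δ := (le_iSup (fun σ => edist (c σ) (b σ)) σ).trans_lt hcb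
  have h2 : edist (c' σ) (b' σ) < δ := (le_iSup (fun σ => edist (c' σ) (b' σ)) σ).trans_lt hcb'
  have h3 : edist (c σ, c' σ) (b σ, b' σ) < δ := by
    rw [Prod.edist_eq]; exact max_lt h1 h2
  exact (h h3 ⟨subset_closure ⟨σ, rfl⟩, subset_closure ⟨σ, rfl⟩⟩ : edist _ _ < ε').le

end WeakPE

/-- The w-PE cochains: the closure of the s-PE cochains in the bounded cochains, with respect to
uniform convergence. -/
def weakPE (A : Type*) [AddCommGroup A] [MetricSpace A] [CompleteSpace A]
    [IsTopologicalAddGroup A] (P : SimplicialTiling d) (n : ℕ) :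
    AddSubgroup (P.simplices n → A) where
  carrier := {c | P.IsWeakPE c}
  zero_mem' := by
    refine ⟨(Set.finite_singleton (0 : A)).isBounded.subset ?_,
      fun ε hε => ⟨0, zero_mem _, ?_⟩⟩
    · rintro _ ⟨σ, rfl⟩; rfl
    · simpa [supEDist] using hε
  add_mem' hc hc' := IsWeakPE.map₂ hc hc' (fun a => a.1 + a.2) continuous_add
    fun _ hb _ hb' => add_mem hb hb'
  neg_mem' hc := IsWeakPE.map₂ hc hc (fun a => -a.1) continuous_fst.neg
    fun _ hb _ _ => neg_mem hb

end SimplicialTiling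

/-! ### Cohomology of a graded subgroup of a graded group with differential -/

section Cohomology

variable {C : ℕ → Type*} [∀ n, AddCommGroup (C n)] (D : ∀ n, C n →+ C (n + 1))
  (S : ∀ n, AddSubgroup (C n))

/-- `S` is a subcomplex on which the differential squares to zero. -/
def IsComplex : Prop :=
  (∀ n, ∀ c ∈ S n, D n c ∈ S (n + 1)) ∧ ∀ n, ∀ c ∈ S n, D (n + 1) (D n c) = 0

/-- The cocycles of degree `n` of `S`. -/
def cocycles (n : ℕ) : AddSubgroup (C n) := S n ⊓ (D n).ker

/-- The coboundaries of degree `n` of `S`. -/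
def coboundaries : ∀ n, AddSubgroup (C n)
  | 0 => ⊥
  | n + 1 => (S n).map (D n)

/-- The cohomology group of degree `n` of `S`: cocycles modulo coboundaries. -/
abbrev Cohomology (n : ℕ) : Type _ :=
  cocycles D S n ⧸ (coboundaries D S n).addSubgroupOf (cocycles D S n)

variable {D S}

/-- The class of a cocycle. -/
def cohomologyClass {n : ℕ} (c : C n) (hc : c ∈ cocycles D S n) : Cohomology D S n :=
  QuotientAddGroup.mk ⟨c, hc⟩

end Cohomology

/-! ### Barycentric coordinates -/

/-! A function on `Ξⁿ` restricts to a cochain through its values at the orbit points `P - p_σ`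
(`orbitRestrict`). The isomorphism is the inverse of this restriction, and everything rests on three
facts about orbit points.

They are dense (`denseRange_orbitPoint`). The punctures of a tiling have no accumulation point, so
two tilings of `Ξⁿ` that are close for `D` agree around the origin without any further translation.
Hence the topology of `Ξⁿ` is that of agreement of patches (`transversal_mem_nhds_iff`), and a
translate of `P` that agrees with a point of `Ξⁿ` around the origin is itself an orbit point.

Combinatorial and metric neighborhoods are cofinal: large patches determine `k`-neighborhoods
(`exists_nhds_sameNeighborhood`), and large `k`-neighborhoods determine patches
(`exists_patch_eq_of_sameNeighborhood`). By the first, an s-PE cochain is constant on the orbit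
points near any given point, so it extends to a locally constant function. The converse needs one
`k` for all points of `Ξⁿ`; this is a compactness argument (`exists_sameNeighborhood_subordinate`),
carried out with limits of tilings along ultrafilters.

Restriction turns `d_PV` into `d_S` (`orbitRestrict_dPV`): at `P - p_σ` only the class of `σ`
contributes, and its partial translations lead to the orbit points of the faces. Thus `d_PV² = 0` on
continuous functions follows from `d_S² = 0` by density, while the stability of PE cochains under
`d_S` follows from that of locally constant or continuous functions under `d_PV`.

In the weak case the same compactness approximates a continuous function on orbit points uniformly
by s-PE cochains, completeness extends a uniform limit of s-PE cochains continuously, and density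
makes restriction isometric. -/

theorem AffineIndependent.eq_of_sum_smul_eq {ι E : Type*} [Fintype ι] [AddCommGroup E] [Module ℝ E]
    {t : ι → E} (ht : AffineIndependent ℝ t) {a b : ι → ℝ} (hab : ∑ i, a i = ∑ i, b i)
    (h : ∑ i, a i • t i = ∑ i, b i • t i) : a = b := by
  funext i
  refine sub_eq_zero.1 (affineIndependent_iff.1 ht Finset.univ (fun i => a i - b i) ?_ ?_ i
    (Finset.mem_univ i))
  · rw [Finset.sum_sub_distrib, hab, sub_self]
  · simp only [sub_smul, Finset.sum_sub_distrib, h, sub_self]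

theorem exists_weights_of_mem_convexHull_image {ι E : Type*} [Fintype ι] [AddCommGroup E]
    [Module ℝ E] {t : ι → E} {J : Set ι} {v : E} (hv : v ∈ convexHull ℝ (t '' J)) :
    ∃ b : ι → ℝ, (∀ i, i ∉ J → b i = 0) ∧ ∑ i, b i = 1 ∧ ∑ i, b i • t i = v := by
  classical
  refine convexHull_min (s := t '' J)
    (t := {v | ∃ b : ι → ℝ, (∀ i, i ∉ J → b i = 0) ∧ ∑ i, b i = 1 ∧ ∑ i, b i • t i = v})
    ?_ ?_ hv
  · rintro _ ⟨j, hj, rfl⟩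
    refine ⟨Pi.single j 1, fun i hi => ?_, ?_, ?_⟩
    · exact Pi.single_eq_of_ne (fun h => hi (by rwa [h])) _
    · simp
    · simp [Pi.single_apply]
  · rintro _ ⟨a, ha0, ha1, rfl⟩ _ ⟨b, hb0, hb1, rfl⟩ x y - - hxy
    refine ⟨fun i => x * a i + y * b i, fun i hi => by simp [ha0 i hi, hb0 i hi], ?_, ?_⟩
    · rw [Finset.sum_add_distrib, ← Finset.mul_sum, ← Finset.mul_sum, ha1, hb1, mul_one, mul_one,
        hxy]
    · simp only [add_smul, mul_smul, Finset.sum_add_distrib, Finset.smul_sum]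

/-- If a relative interior point of a face lies in the convex hull of some vertices, then these
include the vertices of the face. -/
theorem AffineIndependent.range_subset_of_mem_convexHull {ι κ E : Type*} [Fintype ι] [Fintype κ]
    [AddCommGroup E] [Module ℝ E] {t : ι → E} (ht : AffineIndependent ℝ t) (f : κ → ι)
    {w : κ → ℝ} (hw : ∀ k, 0 < w k) (hw1 : ∑ k, w k = 1) {S : Set E} (hS : S ⊆ Set.range t)
    (hv : ∑ k, w k • t (f k) ∈ convexHull ℝ S) : Set.range (t ∘ f) ⊆ S := by
  classical
  have hS' : t '' (t ⁻¹' S) = S := Set.image_preimage_eq_of_subset hS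
  rw [← hS'] at hv
  obtain ⟨b, hb0, hb1, hb⟩ := exists_weights_of_mem_convexHull_image hv
  -- Pushed forward along `f`, the weights `w` represent the same point as `b`, so uniqueness of
  -- barycentric coordinates applies. They are positive at each `f k`, whereas `b` vanishes at
  -- vertices outside `S`.
  have key : (fun i => ∑ k with f k = i, w k) = b := by
    refine ht.eq_of_sum_smul_eq ?_ ?_
    · rw [hb1, ← hw1]
      exact Finset.sum_fiberwise _ _ _
    · rw [hb, ← Finset.sum_fiberwise Finset.univ f]
      refine Finset.sum_congr rfl fun i _ => ?_
      rw [Finset.sum_smul]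
      refine Finset.sum_congr rfl fun k hk => ?_
      rw [(Finset.mem_filter.1 hk).2]
  rintro _ ⟨k, rfl⟩
  by_contra hk
  have h1 := congrFun key (f k)
  rw [hb0 (f k) hk] at h1
  have h2 : 0 < ∑ l with f l = f k, w l :=
    Finset.sum_pos (fun l _ => hw l) ⟨k, by simp⟩
  exact h2.ne' h1

/-- The bounded set of centers has a finite `ρ / 2`-net, and two elements with the same net point
have centers less than `ρ` apart. -/
theorem finite_of_separated_centers {X E : Type*} [PseudoMetricSpace E] [ProperSpace E] {S : Set X}
    {b : X → E} {ρ : ℝ} (hρ : 0 < ρ) (hb : Bornology.IsBounded (b '' S))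
    (hsep : ∀ x ∈ S, ∀ y ∈ S, dist (b x) (b y) < ρ → x = y) : S.Finite := by
  obtain ⟨c, hc, hcov⟩ := Metric.totallyBounded_iff.1
    (hb.isCompact_closure.totallyBounded.subset subset_closure) (ρ / 2) (half_pos hρ)
  have h : ∀ x : S, ∃ y ∈ c, dist (b x) y < ρ / 2 := fun x => by
    simpa using hcov ⟨x, x.2, rfl⟩
  choose g hgc hg using h
  have : Finite c := hc
  have hinj : Function.Injective fun x : S => (⟨g x, hgc x⟩ : c) := by
    intro x y hxy
    have hxy' : g x = g y := congrArg Subtype.val hxy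
    refine Subtype.ext (hsep x x.2 y y.2 ?_)
    have h1 := hg x
    have h2 := hg y
    rw [← hxy'] at h2
    linarith [dist_triangle_right (b x) (b y) (g x)]
  have : Finite S := Finite.of_injective _ hinj
  exact S.toFinite

/-! ### Cells -/

section Cells

variable {d n : ℕ}

theorem isCompact_cell (s : Fin n → Euc d) : IsCompact (cell s) :=
  (Set.finite_range s).isCompact_convexHull ℝ

theorem cell_comp_subset {m : ℕ} (t : Fin m → Euc d) (f : Fin n → Fin m) : cell (t ∘ f) ⊆ cell t :=
  convexHull_mono (Set.range_comp_subset_range f t)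

theorem vertex_mem_cell (s : Fin n → Euc d) (i : Fin n) : s i ∈ cell s :=
  subset_convexHull ℝ _ ⟨i, rfl⟩

/-- The barycenter of a `d`-simplex. -/
noncomputable def barycenter (t : Fin (d + 1) → Euc d) : Euc d := ∑ i, ((d : ℝ) + 1)⁻¹ • t i

theorem sum_barycenter_weights : ∑ _i : Fin (d + 1), ((d : ℝ) + 1)⁻¹ = 1 := by
  rw [Finset.sum_const, Finset.card_univ, Fintype.card_fin, nsmul_eq_mul]
  push_cast
  exact mul_inv_cancel₀ (by positivity)

theorem barycenter_shift (x : Euc d) (t : Fin (d + 1) → Euc d) :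
    barycenter (shift x t) = barycenter t - x := by
  simp only [barycenter, shift, smul_sub, Finset.sum_sub_distrib, ← Finset.sum_smul,
    sum_barycenter_weights, one_smul]

theorem barycenter_mem_cell (t : Fin (d + 1) → Euc d) : barycenter t ∈ cell t :=
  (convex_convexHull ℝ _).sum_mem (fun _ _ => by positivity) sum_barycenter_weights
    fun i _ => vertex_mem_cell t i

/-- The `d + 1` independent points form an affine basis, whose centroid is interior to the hull. -/
theorem exists_ball_subset_cell {t : Fin (d + 1) → Euc d} (ht : AffineIndependent ℝ t) :
    ∃ ρ > 0, Metric.ball (barycenter t) ρ ⊆ cell t := by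
  let b : AffineBasis (Fin (d + 1)) ℝ (Euc d) :=
    ⟨t, ht, ht.affineSpan_eq_top_iff_card_eq_finrank_add_one.2 (by simp)⟩
  have h : barycenter t ∈ interior (cell t) := by
    have h0 := b.centroid_mem_interior_convexHull
    have e : Finset.univ.centroid ℝ b = barycenter t := by
      rw [Finset.centroid_def, Finset.affineCombination_eq_linear_combination _ _ _
        (Finset.univ.sum_centroidWeights_eq_one_of_nonempty ℝ Finset.univ_nonempty)]
      simp [barycenter, Finset.centroidWeights, b]
      rfl
    rwa [e] at h0
  obtain ⟨ρ, hρ, hsub⟩ := Metric.mem_nhds_iff.1 (mem_interior_iff_mem_nhds.1 h)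
  exact ⟨ρ, hρ, hsub⟩

end Cells

theorem Puncturing.pt_shift {d n : ℕ} (p : Puncturing d) {s : Fin (n + 1) → Euc d}
    (hs : AffineIndependent ℝ s) (x : Euc d) : p.pt (shift x s) = p.pt s - x :=
  p.equivariant n s hs x

theorem Puncturing.pt_mem_cell {d n : ℕ} (p : Puncturing d) {s : Fin (n + 1) → Euc d}
    (hs : AffineIndependent ℝ s) : p.pt s ∈ cell s := by
  obtain ⟨w, hw, hw1, h⟩ := p.interior n s hs
  rw [Puncturing.pt, h]
  exact (convex_convexHull ℝ _).sum_mem (fun i _ => (hw i).le) hw1 fun i _ => vertex_mem_cell s i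

namespace SimplicialTiling

variable {d : ℕ}

/-! ### Tiles and simplices of a tiling are determined by interior points -/

/-- Both tiles have `d + 1` vertices, so the vertex sets are equal; equivariance for the zero
translation then forces equal orders. -/
theorem eq_of_range_subset {P : SimplicialTiling d} {t t' : Fin (d + 1) → Euc d}
    (ht : t ∈ P.tiles) (ht' : t' ∈ P.tiles) (h : Set.range t ⊆ Set.range t') : t = t' := by
  have e : Set.range t = Set.range t' := by
    refine Set.eq_of_subset_of_ncard_le h (le_of_eq ?_) (Set.finite_range t')
    rw [← Set.image_univ, ← Set.image_univ,
      Set.ncard_image_of_injective _ (P.affineIndependent t ht).injective,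
      Set.ncard_image_of_injective _ (P.affineIndependent t' ht').injective]
  have := P.equivariant t' ht' t ht 0 (by simpa using e)
  rwa [shift_zero] at this

theorem eq_of_barycenter_mem {P : SimplicialTiling d} {t t' : Fin (d + 1) → Euc d}
    (ht : t ∈ P.tiles) (ht' : t' ∈ P.tiles) (h : barycenter t ∈ cell t') : t = t' := by
  have hm : barycenter t ∈ convexHull ℝ (Set.range t ∩ Set.range t') := by
    rw [← P.face_to_face t ht t' ht']
    exact ⟨barycenter_mem_cell t, h⟩
  have := (P.affineIndependent t ht).range_subset_of_mem_convexHull id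
    (w := fun _ => ((d : ℝ) + 1)⁻¹) (fun _ => by positivity) sum_barycenter_weights
    Set.inter_subset_left hm
  exact eq_of_range_subset ht ht' (this.trans Set.inter_subset_right)

theorem pt_comp_mem_cell {P : SimplicialTiling d} (p : Puncturing d) {n : ℕ}
    {t : Fin (d + 1) → Euc d} (ht : t ∈ P.tiles) (f : Fin (n + 1) ↪o Fin (d + 1)) :
    p.pt (t ∘ f) ∈ cell t :=
  cell_comp_subset t f
    (p.pt_mem_cell ((P.affineIndependent t ht).comp_embedding f.toEmbedding))

/-- Since tiles meet face to face, the puncture lies in the hull of the common vertices. It is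
interior to its simplex, so all vertices of the simplex are common. -/
theorem range_subset_of_pt_mem {P : SimplicialTiling d} (p : Puncturing d) {n : ℕ}
    {t t' : Fin (d + 1) → Euc d} (ht : t ∈ P.tiles) (ht' : t' ∈ P.tiles)
    (f : Fin (n + 1) ↪o Fin (d + 1)) (h : p.pt (t ∘ f) ∈ cell t') :
    Set.range (t ∘ f) ⊆ Set.range t' := by
  obtain ⟨w, hw, hw1, hp⟩ := p.interior n _
    ((P.affineIndependent t ht).comp_embedding f.toEmbedding)
  have hm : p.pt (t ∘ f) ∈ convexHull ℝ (Set.range t ∩ Set.range t') := by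
    rw [← P.face_to_face t ht t' ht']
    exact ⟨pt_comp_mem_cell p ht f, h⟩
  have e : p.pt (t ∘ f) = ∑ i, w i • (t ∘ f) i := hp
  rw [e] at hm
  exact ((P.affineIndependent t ht).range_subset_of_mem_convexHull f hw hw1
    Set.inter_subset_left hm).trans Set.inter_subset_right

/-- A simplex of a tiling is determined by its dimension and its puncture. -/
theorem eq_of_pt_eq {P : SimplicialTiling d} (p : Puncturing d) {n : ℕ}
    {s s' : Fin (n + 1) → Euc d} (hs : s ∈ P.simplices n) (hs' : s' ∈ P.simplices n)
    (h : p.pt s = p.pt s') : s = s' := by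
  obtain ⟨t, ht, f, rfl⟩ := hs
  obtain ⟨t', ht', f', rfl⟩ := hs'
  have hsub' : Set.range (t' ∘ f') ⊆ Set.range t :=
    range_subset_of_pt_mem p ht' ht f' (h ▸ pt_comp_mem_cell p ht f)
  have hA' := (P.affineIndependent t' ht').comp_embedding f'.toEmbedding
  -- Both simplices are now faces of the single tile `t`. The common puncture is interior to each of
  -- them, so they have the same vertices.
  choose g hg using fun i => hsub' ⟨i, rfl⟩
  have hg' : t ∘ g = t' ∘ f' := funext hg
  obtain ⟨w, hw, hw1, hp⟩ := p.interior n _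
    ((P.affineIndependent t ht).comp_embedding f.toEmbedding)
  obtain ⟨w', hw', hw1', hp'⟩ := p.interior n (t' ∘ f') hA'
  have r1 : Set.range (t ∘ f) ⊆ Set.range (t ∘ g) := by
    refine (P.affineIndependent t ht).range_subset_of_mem_convexHull f hw hw1
      (Set.range_comp_subset_range _ _) ?_
    have e : ∑ k, w k • t (f k) = p.pt (t' ∘ f') := hp.symm.trans h
    rw [e, hg']
    exact p.pt_mem_cell hA'
  have r2 : Set.range (t ∘ g) ⊆ Set.range (t ∘ f) := by
    refine (P.affineIndependent t ht).range_subset_of_mem_convexHull g hw' hw1'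
      (Set.range_comp_subset_range _ _) ?_
    have e : ∑ k, w' k • t (g k) = p.pt (t ∘ f) := by
      simp only [hg]; exact hp'.symm.trans h.symm
    rw [e]
    exact p.pt_mem_cell ((P.affineIndependent t ht).comp_embedding f.toEmbedding)
  have hr : Set.range f = Set.range g := by
    have := r1.antisymm r2
    rw [Set.range_comp, Set.range_comp] at this
    exact (P.affineIndependent t ht).injective.image_injective this
  -- Compatibility of the orders makes `g` increasing, and an increasing map on `Fin (n + 1)` is
  -- determined by its range.
  have hmono : StrictMono g := fun i j hij =>
    P.order_compat t' ht' t ht _ _ _ _ (hg i).symm (hg j).symm (f'.strictMono hij)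
  have hfg : (f : Fin (n + 1) → Fin (d + 1)) = g := (f.strictMono.range_inj hmono).1 hr
  rw [hfg, hg']

/-! ### Local finiteness -/

theorem exists_dist_le (P : SimplicialTiling d) :
    ∃ L : ℝ, 0 ≤ L ∧ ∀ t ∈ P.tiles, ∀ u ∈ cell t, ∀ v ∈ cell t, dist u v ≤ L := by
  obtain ⟨F, hF, hFt⟩ := P.finite_prototiles
  have hb : ∃ L : ℝ, ∀ q ∈ F, Metric.diam (cell q) ≤ L := by
    obtain ⟨L, hL⟩ := (hF.image fun q => Metric.diam (cell q)).bddAbove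
    exact ⟨L, fun q hq => hL ⟨q, hq, rfl⟩⟩
  obtain ⟨L, hL⟩ := hb
  refine ⟨max L 0, le_max_right _ _, fun t ht u hu v hv => ?_⟩
  obtain ⟨q, hq, x, rfl⟩ := hFt t ht
  rw [cell_shift] at hu hv
  obtain ⟨u, hu, rfl⟩ := hu
  obtain ⟨v, hv, rfl⟩ := hv
  rw [dist_sub_right]
  exact ((Metric.dist_le_diam_of_mem (isCompact_cell q).isBounded hu hv).trans (hL q hq)).trans
    (le_max_left _ _)

theorem exists_inradius (P : SimplicialTiling d) :
    ∃ ρ : ℝ, 0 < ρ ∧ ∀ t ∈ P.tiles, Metric.ball (barycenter t) ρ ⊆ cell t := by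
  obtain ⟨F, hF, hFt⟩ := P.finite_prototiles
  -- `F` may contain lists that do not occur in `P`, so independence is only assumed here. Stating
  -- the bound for all small `ρ` lets the finitely many prototiles share one radius.
  have h : ∀ q ∈ F, ∀ᶠ ρ in nhdsWithin (0 : ℝ) (Set.Ioi 0),
      AffineIndependent ℝ q → Metric.ball (barycenter q) ρ ⊆ cell q := by
    intro q _
    by_cases hq : AffineIndependent ℝ q
    · obtain ⟨ρ, hρ, hsub⟩ := exists_ball_subset_cell hq
      filter_upwards [Ioo_mem_nhdsGT hρ] with r hr _
      exact (Metric.ball_subset_ball hr.2.le).trans hsub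
    · exact Filter.Eventually.of_forall fun _ h => absurd h hq
  obtain ⟨ρ, hρ, h0⟩ := (((Filter.eventually_all_finite hF).2 h).and self_mem_nhdsWithin).exists
  refine ⟨ρ, h0, fun t ht => ?_⟩
  obtain ⟨q, hq, x, rfl⟩ := hFt t ht
  have hA : AffineIndependent ℝ q := by
    have := affineIndependent_shift (-x) (P.affineIndependent _ ht)
    rwa [shift_shift, add_neg_cancel, shift_zero] at this
  intro v hv
  rw [cell_shift]
  refine ⟨v + x, hρ q hq hA ?_, by simp⟩
  rw [barycenter_shift, Metric.mem_ball, dist_eq_norm] at hv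
  rw [Metric.mem_ball, dist_eq_norm]
  convert hv using 2
  abel

/-- Only finitely many tiles meet a bounded set. -/
theorem finite_tiles_meeting (P : SimplicialTiling d) {B : Set (Euc d)}
    (hB : Bornology.IsBounded B) : {t | t ∈ P.tiles ∧ (cell t ∩ B).Nonempty}.Finite := by
  obtain ⟨L, -, hL⟩ := P.exists_dist_le
  obtain ⟨ρ, hρ, hin⟩ := P.exists_inradius
  -- The barycenters lie within `L` of `B`. If two are closer than the inradius, one barycenter lies
  -- in the other tile, so the tiles coincide.
  refine finite_of_separated_centers (b := barycenter) hρ ?_ fun t ht t' ht' h => ?_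
  · refine (hB.cthickening (δ := L)).subset ?_
    rintro _ ⟨t, ⟨ht, v, hv, hvB⟩, rfl⟩
    exact Metric.mem_cthickening_of_dist_le _ v _ _ hvB (hL t ht _ (barycenter_mem_cell t) v hv)
  · exact eq_of_barycenter_mem ht.1 ht'.1 (hin t' ht'.1 h)

theorem finite_patch (P : SimplicialTiling d) (r : ℝ) : (P.patch r).Finite :=
  P.finite_tiles_meeting Metric.isBounded_ball

/-- Tiles close to a given tile touch it. -/
theorem exists_touching_radius (P : SimplicialTiling d) {t : Fin (d + 1) → Euc d} :
    ∃ δ : ℝ, 0 < δ ∧ ∀ u ∈ P.tiles, ∀ v ∈ cell t, ∀ w ∈ cell u, dist v w < δ →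
      (cell u ∩ cell t).Nonempty := by
  -- Only finitely many tiles come within distance `1`, and each of them that misses the compact
  -- `cell t` has positive distance from it.
  have hfin := P.finite_tiles_meeting ((isCompact_cell t).isBounded.cthickening (δ := 1))
  have h : ∀ u ∈ {u | u ∈ P.tiles ∧ (cell u ∩ Metric.cthickening 1 (cell t)).Nonempty},
      ∀ᶠ δ in nhdsWithin (0 : ℝ) (Set.Ioi 0), ∀ v ∈ cell t, ∀ w ∈ cell u, dist v w < δ →
        (cell u ∩ cell t).Nonempty := by
    intro u _
    by_cases hne : (cell u ∩ cell t).Nonempty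
    · exact Filter.Eventually.of_forall fun _ _ _ _ _ _ => hne
    have hd : Disjoint (cell t) (cell u) := by
      rw [Set.disjoint_iff_inter_eq_empty, Set.inter_comm]
      exact Set.not_nonempty_iff_eq_empty.1 hne
    obtain ⟨δ, hδ, hdis⟩ := hd.exists_thickenings (isCompact_cell t) (isCompact_cell u).isClosed
    filter_upwards [Ioo_mem_nhdsGT hδ] with r hr v hv w hw hvw
    have hw' : w ∈ Metric.thickening δ (cell t) :=
      Metric.mem_thickening_iff.2 ⟨v, hv, by rw [dist_comm]; exact hvw.trans hr.2⟩
    exact absurd (Metric.self_subset_thickening hδ _ hw) (Set.disjoint_left.1 hdis hw')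
  obtain ⟨δ, hδ, h0⟩ := (((Filter.eventually_all_finite hfin).2 h).and
    (Ioo_mem_nhdsGT one_pos)).exists
  refine ⟨δ, h0.1, fun u hu v hv w hw hvw => hδ u ⟨hu, w, hw, ?_⟩ v hv w hw hvw⟩
  refine Metric.mem_cthickening_of_dist_le _ v _ _ hv ?_
  rw [dist_comm]
  exact hvw.le.trans h0.2.le

/-! ### Neighborhoods -/

theorem translate_zero (P : SimplicialTiling d) : translate 0 P = P :=
  ext' (by simp only [translate, shift_zero, Set.image_id'])

theorem translate_neg_translate (x : Euc d) (P : SimplicialTiling d) :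
    translate (-x) (translate x P) = P := by
  rw [translate_translate, add_neg_cancel, translate_zero]

theorem neighborhood_subset_tiles (P : SimplicialTiling d) {n : ℕ} (s : Fin (n + 1) → Euc d)
    (k : ℕ) : P.neighborhood s k ⊆ P.tiles := by
  cases k <;> exact fun t ht => ht.1

theorem neighborhood_translate (P : SimplicialTiling d) {n : ℕ} (s : Fin (n + 1) → Euc d)
    (x : Euc d) (k : ℕ) :
    (translate x P).neighborhood (shift x s) k = shift x '' P.neighborhood s k := by
  have hinj : Function.Injective fun v : Euc d => v - x := sub_left_injective
  induction k with
  | zero =>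
    ext t
    constructor
    · rintro ⟨⟨t, ht, rfl⟩, h⟩
      rw [range_shift, range_shift, Set.image_subset_image_iff hinj] at h
      exact ⟨t, ⟨ht, h⟩, rfl⟩
    · rintro ⟨t, ⟨ht, h⟩, rfl⟩
      refine ⟨⟨t, ht, rfl⟩, ?_⟩
      rw [range_shift, range_shift]
      exact Set.image_mono h
  | succ k ih =>
    ext t
    constructor
    · rintro ⟨⟨t, ht, rfl⟩, u, hu, hne⟩
      rw [ih] at hu
      obtain ⟨u, hu, rfl⟩ := hu
      rw [cell_shift, cell_shift, image_sub_inter, Set.image_nonempty] at hne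
      exact ⟨t, ⟨ht, u, hu, hne⟩, rfl⟩
    · rintro ⟨t, ⟨ht, u, hu, hne⟩, rfl⟩
      refine ⟨⟨t, ht, rfl⟩, shift x u, ih ▸ ⟨u, hu, rfl⟩, ?_⟩
      rw [cell_shift, cell_shift, image_sub_inter, Set.image_nonempty]
      exact hne

theorem neighborhood_zero_of_tile {P : SimplicialTiling d} {t u : Fin (d + 1) → Euc d}
    (ht : t ∈ P.tiles) (hu : u ∈ P.neighborhood t 0) : u = t :=
  (eq_of_range_subset ht hu.1 hu.2).symm

theorem finite_range_simplex_shift (P : SimplicialTiling d) (n : ℕ) :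
    (Set.range fun σ : P.simplices n => shift (σ.1 0) σ.1).Finite := by
  obtain ⟨F, hF, hFt⟩ := P.finite_prototiles
  have : Finite (Fin (n + 1) ↪o Fin (d + 1)) :=
    Finite.of_injective (fun f => (f : Fin (n + 1) → Fin (d + 1))) DFunLike.coe_injective
  refine (Set.finite_iUnion fun f : Fin (n + 1) ↪o Fin (d + 1) =>
    hF.image fun q => shift (q (f 0)) (q ∘ f)).subset ?_
  rintro _ ⟨⟨s, t, ht, f, rfl⟩, rfl⟩
  obtain ⟨q, hq, x, rfl⟩ := hFt t ht
  refine Set.mem_iUnion.2 ⟨f, q, hq, ?_⟩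
  funext j
  simp [shift]

theorem tile_mem_simplices {P : SimplicialTiling d} {t : Fin (d + 1) → Euc d}
    (ht : t ∈ P.tiles) : t ∈ P.simplices d :=
  ⟨t, ht, RelEmbedding.refl _, rfl⟩

/-- A uniform neighborhood of every tile is covered by the tiles that touch it. -/
theorem exists_covering_radius (P : SimplicialTiling d) :
    ∃ δ : ℝ, 0 < δ ∧ ∀ t ∈ P.tiles, ∀ v ∈ cell t, ∀ w, dist v w < δ →
      ∃ u ∈ P.tiles, w ∈ cell u ∧ (cell u ∩ cell t).Nonempty := by
  obtain ⟨G, hG, hGs⟩ := P.neighborhood_finite 1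
  -- An admissible radius depends only on the tile with the tiles touching it, up to translation.
  -- There are finitely many such data, which makes the radius uniform.
  let Ψ : P.tiles → (Fin (d + 1) → Euc d) × Set (Fin (d + 1) → Euc d) := fun t =>
    (shift (t.1 0) t.1, shift (t.1 0) '' P.neighborhood t.1 1)
  have hΨ : (Set.range Ψ).Finite := by
    refine ((P.finite_range_simplex_shift d).prod hG.powerset).subset ?_
    rintro _ ⟨t, rfl⟩
    exact ⟨⟨⟨t.1, tile_mem_simplices t.2⟩, rfl⟩, hGs d t.1⟩
  have h : ∀ y ∈ Set.range Ψ, ∀ᶠ δ in nhdsWithin (0 : ℝ) (Set.Ioi 0),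
      ∀ v ∈ cell y.1, ∀ w, dist v w < δ → ∃ u ∈ y.2, w ∈ cell u := by
    rintro _ ⟨⟨t, ht⟩, rfl⟩
    obtain ⟨δ, hδ, h⟩ := P.exists_touching_radius (t := t)
    filter_upwards [Ioo_mem_nhdsGT hδ] with r hr v hv w hvw
    dsimp only [Ψ] at hv
    rw [cell_shift] at hv
    obtain ⟨v, hv, rfl⟩ := hv
    obtain ⟨u, hu, hwu⟩ := P.cover (w + t 0)
    refine ⟨shift (t 0) u, ⟨u, ⟨hu, t, ⟨ht, subset_rfl⟩, h u hu v hv _ hwu ?_⟩, rfl⟩, ?_⟩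
    · refine lt_trans ?_ hr.2
      have e : v - (w + t 0) = v - t 0 - w := by abel
      rw [dist_eq_norm] at hvw ⊢
      rwa [e]
    · rw [cell_shift]
      exact ⟨_, hwu, by simp⟩
  obtain ⟨δ, hδ, h0⟩ := (((Filter.eventually_all_finite hΨ).2 h).and self_mem_nhdsWithin).exists
  refine ⟨δ, h0, fun t ht v hv w hvw => ?_⟩
  obtain ⟨u, ⟨u, ⟨hu, t', ht', hne⟩, rfl⟩, hwu⟩ := hδ (Ψ ⟨t, ht⟩) ⟨_, rfl⟩ (v - t 0)
    (by dsimp only [Ψ]; rw [cell_shift]; exact ⟨v, hv, rfl⟩) (w - t 0)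
    (by rwa [dist_sub_right])
  dsimp only at hwu
  rw [cell_shift] at hwu
  obtain ⟨w', hw', e⟩ := hwu
  rw [neighborhood_zero_of_tile ht ht'] at hne
  exact ⟨u, hu, sub_left_injective e ▸ hw', hne⟩

/-- Large neighborhoods of a simplex contain all the tiles in a given distance of it. -/
theorem exists_neighborhood_covers (P : SimplicialTiling d) (R : ℝ) :
    ∃ k : ℕ, ∀ (n : ℕ), ∀ s ∈ P.simplices n, ∀ v ∈ cell s, ∀ t ∈ P.tiles,
      (cell t ∩ Metric.ball v R).Nonempty → t ∈ P.neighborhood s k := by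
  obtain ⟨δ, hδ, hcov⟩ := P.exists_covering_radius
  obtain ⟨m, hm⟩ := exists_nat_ge (R / (δ / 2))
  rw [div_le_iff₀ (half_pos hδ)] at hm
  -- Steps of length `δ / 2` along a segment from `v` reach any `w` in the ball through `m`
  -- successive touching tiles. The additional step passes from the tile found at `w` to `t`, which
  -- touches it at `w`.
  refine ⟨m + 1, fun n s hs v hv => ?_⟩
  have key : ∀ (m : ℕ) (w : Euc d), dist v w ≤ m * (δ / 2) →
      ∃ t ∈ P.neighborhood s m, w ∈ cell t := by
    intro m
    induction m with
    | zero =>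
      intro w hw
      have hvw : v = w := dist_le_zero.1 (by simpa using hw)
      obtain ⟨t, ht, f, rfl⟩ := hs
      exact ⟨t, ⟨ht, Set.range_comp_subset_range _ _⟩, hvw ▸ cell_comp_subset t f hv⟩
    | succ m ih =>
      intro w hw
      rw [dist_eq_norm, norm_sub_rev] at hw
      have hm1 : (0 : ℝ) < m + 1 := by positivity
      push_cast at hw
      obtain ⟨t, ht, hwt⟩ := ih (v + ((m : ℝ) / (m + 1)) • (w - v)) (by
        rw [dist_self_add_right, norm_smul, Real.norm_of_nonneg (by positivity), div_mul_eq_mul_div,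
          div_le_iff₀ hm1]
        nlinarith [mul_le_mul_of_nonneg_left hw (Nat.cast_nonneg (α := ℝ) m)])
      obtain ⟨u, hu, hwu, hne⟩ := hcov t (P.neighborhood_subset_tiles s m ht) _ hwt w (by
        have e : v + ((m : ℝ) / (m + 1)) • (w - v) - w = (-(1 / ((m : ℝ) + 1))) • (w - v) := by
          have : (m : ℝ) / (m + 1) = 1 + -(1 / ((m : ℝ) + 1)) := by field_simp; ring
          rw [this, add_smul, one_smul]
          abel
        rw [dist_eq_norm, e, norm_smul, norm_neg, Real.norm_of_nonneg (by positivity),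
          div_mul_eq_mul_div, one_mul, div_lt_iff₀ hm1]
        nlinarith)
      exact ⟨u, ⟨hu, t, ht, hne⟩, hwu⟩
  rintro t ht ⟨w, hwt, hw⟩
  rw [Metric.mem_ball, dist_comm] at hw
  obtain ⟨u, hu, hwu⟩ := key m w (hw.le.trans hm)
  exact ⟨ht, u, hu, w, hwt, hwu⟩

/-! ### Patches around the origin -/

theorem patch_congr {P Q : SimplicialTiling d} {r R : ℝ} (h : P.patch R = Q.patch R)
    (hr : r ≤ R) : P.patch r = Q.patch r := by
  have := patch_translate (x := 0) (R := r) h (by rwa [norm_zero, add_zero])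
  rwa [translate_zero, translate_zero] at this

theorem mem_patch {P : SimplicialTiling d} {r : ℝ} {t : Fin (d + 1) → Euc d} {v : Euc d}
    (ht : t ∈ P.tiles) (hv : v ∈ cell t) (hr : ‖v‖ < r) : t ∈ P.patch r :=
  ⟨ht, v, hv, mem_ball_zero_iff.2 hr⟩

theorem mem_tiles_of_patch_eq {P Q : SimplicialTiling d} {r : ℝ} (h : P.patch r = Q.patch r)
    {t : Fin (d + 1) → Euc d} {v : Euc d} (ht : t ∈ P.tiles) (hv : v ∈ cell t) (hr : ‖v‖ < r) :
    t ∈ Q.tiles :=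
  (h ▸ mem_patch ht hv hr : t ∈ Q.patch r).1

theorem mem_simplices_of_patch_eq {P Q : SimplicialTiling d} {r : ℝ} (h : P.patch r = Q.patch r)
    (p : Puncturing d) {n : ℕ} {s : Fin (n + 1) → Euc d} (hs : s ∈ P.simplices n)
    (hr : ‖p.pt s‖ < r) : s ∈ Q.simplices n := by
  obtain ⟨t, ht, f, rfl⟩ := hs
  exact ⟨t, mem_tiles_of_patch_eq h ht (pt_comp_mem_cell p ht f) hr, f, rfl⟩

/-- A chain of `k + 1` touching tiles, each of diameter at most `L`, leads from the origin to `v`.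
-/
theorem norm_le_of_mem_neighborhood {P : SimplicialTiling d} {L : ℝ}
    (hL : ∀ t ∈ P.tiles, ∀ u ∈ cell t, ∀ v ∈ cell t, dist u v ≤ L) {n : ℕ}
    {s : Fin (n + 1) → Euc d} (hs : 0 ∈ cell s) (k : ℕ) :
    ∀ t ∈ P.neighborhood s k, ∀ v ∈ cell t, ‖v‖ ≤ (k + 1) * L := by
  induction k with
  | zero =>
    intro t ht v hv
    have := hL t ht.1 v hv 0 (convexHull_mono ht.2 hs)
    simpa using this
  | succ k ih =>
    rintro t ⟨ht, u, hu, w, hwt, hwu⟩ v hv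
    have h1 := hL t ht v hv w hwt
    have h2 := ih u hu w hwu
    rw [dist_eq_norm] at h1
    have h3 := norm_add_le (v - w) w
    rw [sub_add_cancel] at h3
    push_cast
    linarith

/-- Each tile added in the recursion touches an earlier tile at a point of norm less than `R`, so it
belongs to the common patch. -/
theorem neighborhood_congr {P Q : SimplicialTiling d} {L R : ℝ} (hL0 : 0 ≤ L)
    (hP : ∀ t ∈ P.tiles, ∀ u ∈ cell t, ∀ v ∈ cell t, dist u v ≤ L)
    (hQ : ∀ t ∈ Q.tiles, ∀ u ∈ cell t, ∀ v ∈ cell t, dist u v ≤ L)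
    (h : P.patch R = Q.patch R) {n : ℕ} {s : Fin (n + 1) → Euc d} (hs : 0 ∈ cell s) (k : ℕ)
    (hk : (k + 1) * L < R) : P.neighborhood s k = Q.neighborhood s k := by
  induction k with
  | zero =>
    have hR : ‖(0 : Euc d)‖ < R := by
      rw [norm_zero]; push_cast at hk; linarith
    ext t
    constructor
    · rintro ⟨ht, hst⟩
      exact ⟨mem_tiles_of_patch_eq h ht (convexHull_mono hst hs) hR, hst⟩
    · rintro ⟨ht, hst⟩
      exact ⟨mem_tiles_of_patch_eq h.symm ht (convexHull_mono hst hs) hR, hst⟩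
  | succ k ih =>
    push_cast at hk
    have ih' := ih (by linarith)
    ext t
    constructor
    · rintro ⟨ht, u, hu, w, hwt, hwu⟩
      have := norm_le_of_mem_neighborhood hP hs k u hu w hwu
      exact ⟨mem_tiles_of_patch_eq h ht hwt (by linarith), u, ih' ▸ hu, w, hwt, hwu⟩
    · rintro ⟨ht, u, hu, w, hwt, hwu⟩
      have := norm_le_of_mem_neighborhood hQ hs k u hu w hwu
      exact ⟨mem_tiles_of_patch_eq h.symm ht hwt (by linarith), u, ih' ▸ hu, w, hwt, hwu⟩

theorem dist_le_translate {P : SimplicialTiling d} {L : ℝ}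
    (hL : ∀ t ∈ P.tiles, ∀ u ∈ cell t, ∀ v ∈ cell t, dist u v ≤ L) (x : Euc d) :
    ∀ t ∈ (translate x P).tiles, ∀ u ∈ cell t, ∀ v ∈ cell t, dist u v ≤ L := by
  rintro _ ⟨t, ht, rfl⟩ u hu v hv
  rw [cell_shift] at hu hv
  obtain ⟨u, hu, rfl⟩ := hu
  obtain ⟨v, hv, rfl⟩ := hv
  rw [dist_sub_right]
  exact hL t ht u hu v hv

/-- Finite local complexity: there are only finitely many patches of given size around the
punctures. -/
theorem exists_finite_patches (P : SimplicialTiling d) (p : Puncturing d) (n : ℕ) (R : ℝ) :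
    ∃ G : Set (Fin (d + 1) → Euc d), G.Finite ∧
      ∀ σ : P.simplices n, (translate (p.pt σ.1) P).patch R ⊆ G := by
  obtain ⟨k, hk⟩ := P.exists_neighborhood_covers R
  obtain ⟨G, hG, hGs⟩ := P.neighborhood_finite k
  -- Simplices and neighborhoods are normalized at the first vertex; moving from there to the
  -- puncture depends only on the normalized simplex.
  refine ⟨Set.image2 (fun s t => shift (p.pt s) t)
    (Set.range fun σ : P.simplices n => shift (σ.1 0) σ.1) G,
    (P.finite_range_simplex_shift n).image2 _ hG, ?_⟩
  rintro σ _ ⟨⟨t, ht, rfl⟩, w, hwt, hw⟩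
  have hA := simplices_affineIndependent σ.2
  rw [cell_shift] at hwt
  obtain ⟨w, hwt, rfl⟩ := hwt
  have ht' : t ∈ P.neighborhood σ.1 k := by
    refine hk n σ.1 σ.2 (p.pt σ.1) (p.pt_mem_cell hA) t ht ⟨w, hwt, ?_⟩
    rwa [Metric.mem_ball, dist_eq_norm, ← mem_ball_zero_iff]
  refine ⟨_, ⟨σ, rfl⟩, _, hGs n σ.1 ⟨t, ht', rfl⟩, ?_⟩
  dsimp only
  rw [p.pt_shift hA, shift_shift, add_sub_cancel]

/-! ### The topology of the transversals -/

theorem exists_patch_eq_of_tilingDist_lt {P Q : SimplicialTiling d} {r : ℝ} (hr : 0 < r)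
    (h : tilingDist P Q < 1 / (r + 1)) : ∃ x y : Euc d, ‖x‖ < 1 / r ∧ ‖y‖ < 1 / r ∧
      (translate x P).patch r = (translate y Q).patch r := by
  obtain ⟨e, he, hlt⟩ := exists_lt_of_csInf_lt ⟨1, Set.mem_insert _ _⟩ h
  rcases he with rfl | ⟨s, hs, rfl, a, ha, b, hb, hab⟩
  · exfalso
    rw [lt_div_iff₀ (by positivity)] at hlt
    linarith
  have hrs : r < s := by
    rw [div_lt_div_iff₀ (by positivity) (by positivity)] at hlt
    linarith
  have hle : 1 / s ≤ 1 / r := one_div_le_one_div_of_le hr hrs.le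
  rw [mem_ball_zero_iff] at ha hb
  exact ⟨a, b, ha.trans_le hle, hb.trans_le hle, patch_congr hab hrs.le⟩

theorem tilingDist_le {P Q : SimplicialTiling d} {r : ℝ} (hr : 0 < r) {x y : Euc d}
    (hx : ‖x‖ < 1 / r) (hy : ‖y‖ < 1 / r)
    (h : (translate x P).patch r = (translate y Q).patch r) : tilingDist P Q ≤ 1 / (r + 1) := by
  refine csInf_le ⟨0, ?_⟩ (Set.mem_insert_of_mem _ ⟨r, hr, rfl, x, mem_ball_zero_iff.2 hx, y,
    mem_ball_zero_iff.2 hy, h⟩)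
  rintro e (rfl | ⟨r, hr, rfl, -⟩)
  · exact zero_le_one
  · positivity

theorem tilingDist_le_of_patch_eq {P Q : SimplicialTiling d} {r : ℝ} (hr : 0 < r)
    (h : P.patch r = Q.patch r) : tilingDist P Q ≤ 1 / (r + 1) :=
  tilingDist_le (x := 0) (y := 0) hr (by simpa using hr) (by simpa using hr)
    (by rwa [translate_zero, translate_zero])

theorem exists_one_div_add_one_lt {ε : ℝ} (hε : 0 < ε) : ∃ r : ℝ, 0 < r ∧ 1 / (r + 1) < ε := by
  refine ⟨1 / ε, by positivity, ?_⟩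
  rw [div_lt_iff₀ (by positivity)]
  have : ε * (1 / ε) = 1 := by field_simp
  nlinarith

/-- This substitute for the triangle inequality is enough for balls of `D` to be neighborhoods of
their centers. -/
theorem tilingDist_weak_triangle {ε : ℝ} (hε : 0 < ε) : ∃ ε' : ℝ, 0 < ε' ∧
    ∀ P Q T : SimplicialTiling d, tilingDist P Q < ε' → tilingDist Q T < ε' →
      tilingDist P T < ε := by
  obtain ⟨s, hs, hlt⟩ := exists_one_div_add_one_lt hε
  -- At this radius translations are shorter than `1`, so a common patch of radius `s` survives
  -- them, and two of them add up to less than `1 / s`.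
  have hr : 0 < 2 * s + 2 := by positivity
  refine ⟨1 / (2 * s + 2 + 1), by positivity, fun P Q T h h' => lt_of_le_of_lt ?_ hlt⟩
  obtain ⟨a, b, ha, hb, hab⟩ := exists_patch_eq_of_tilingDist_lt hr h
  obtain ⟨a', b', ha', hb', hab'⟩ := exists_patch_eq_of_tilingDist_lt hr h'
  have h1 : 1 / (2 * s + 2) ≤ 1 := by
    rw [div_le_one hr]; linarith
  have h2 : 2 * (1 / (2 * s + 2)) ≤ 1 / s := by
    rw [mul_one_div, div_le_div_iff₀ hr hs]; linarith
  refine tilingDist_le (x := a + a') (y := b' + b) hs ?_ ?_ ?_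
  · exact (norm_add_le _ _).trans_lt (by linarith)
  · exact (norm_add_le _ _).trans_lt (by linarith)
  · rw [← translate_translate, ← translate_translate]
    refine (patch_translate hab (by linarith)).trans ?_
    rw [translate_comm]
    exact patch_translate hab' (by linarith)

theorem tiling_mem_nhds_iff {Q : SimplicialTiling d} {U : Set (SimplicialTiling d)} :
    U ∈ nhds Q ↔ ∃ ε : ℝ, 0 < ε ∧ ∀ Q', tilingDist Q Q' < ε → Q' ∈ U := by
  have hself : ∀ (Q : SimplicialTiling d) {ε : ℝ}, 0 < ε → tilingDist Q Q < ε := fun Q ε hε => by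
    obtain ⟨r, hr, hlt⟩ := exists_one_div_add_one_lt hε
    exact (tilingDist_le_of_patch_eq hr rfl).trans_lt hlt
  constructor
  · intro h
    obtain ⟨V, hVU, hV, hQ⟩ := mem_nhds_iff.1 h
    obtain ⟨ε, hε, hsub⟩ := hV Q hQ
    exact ⟨ε, hε, fun Q' h' => hVU (hsub Q' h')⟩
  · intro h
    refine mem_nhds_iff.2 ⟨{Q | ∃ ε : ℝ, 0 < ε ∧ ∀ Q', tilingDist Q Q' < ε → Q' ∈ U}, ?_, ?_, h⟩
    · rintro Q ⟨ε, hε, hsub⟩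
      exact hsub Q (hself Q hε)
    · rintro Q ⟨ε, hε, hsub⟩
      obtain ⟨ε', hε', htri⟩ := tilingDist_weak_triangle (d := d) hε
      exact ⟨ε', hε', fun Q' hQ' => ⟨ε', hε', fun Q'' hQ'' => hsub _ (htri _ _ _ hQ' hQ'')⟩⟩

theorem mem_hull_iff {P Q : SimplicialTiling d} :
    Q ∈ P.hull ↔ ∀ R : ℝ, ∃ x : Euc d, (translate x P).patch R = Q.patch R := by
  rw [hull, mem_closure_iff_nhds]
  constructor
  · intro h R
    have hr : 0 < max R 0 + 1 := by positivity
    obtain ⟨_, hQ', y, rfl⟩ := h {Q' | tilingDist Q Q' < 1 / (max R 0 + 1 + 1)}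
      (tiling_mem_nhds_iff.2 ⟨_, by positivity, fun _ h => h⟩)
    obtain ⟨a, b, ha, -, hab⟩ := exists_patch_eq_of_tilingDist_lt hr hQ'
    have h1 : 1 / (max R 0 + 1) ≤ 1 := by
      rw [div_le_one hr]; linarith [le_max_right R 0]
    -- The translation on the side of `Q` is undone, at the cost of at most `1` in the radius; the
    -- one on the side of `P` is absorbed into the orbit.
    have h2 := patch_translate (x := -a) (R := R) hab (by
      rw [norm_neg]; linarith [le_max_left R 0])
    rw [translate_neg_translate, translate_translate, translate_translate] at h2
    exact ⟨_, h2.symm⟩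
  · intro h U hU
    obtain ⟨ε, hε, hsub⟩ := tiling_mem_nhds_iff.1 hU
    obtain ⟨r, hr, hlt⟩ := exists_one_div_add_one_lt hε
    obtain ⟨x, hx⟩ := h r
    exact ⟨_, hsub _ ((tilingDist_le_of_patch_eq hr hx.symm).trans_lt hlt), x, rfl⟩

theorem exists_puncture_gap (P : SimplicialTiling d) (p : Puncturing d) (n : ℕ) :
    ∃ δ : ℝ, 0 < δ ∧ ∀ v ∈ P.punctures p n, ‖v‖ < δ → v = 0 := by
  have : Finite (Fin (n + 1) ↪o Fin (d + 1)) :=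
    Finite.of_injective (fun f => (f : Fin (n + 1) → Fin (d + 1))) DFunLike.coe_injective
  have hfin : (⋃ f : Fin (n + 1) ↪o Fin (d + 1), (fun t => p.pt (t ∘ f)) '' P.patch 1).Finite :=
    Set.finite_iUnion fun f => (P.finite_patch 1).image _
  have h : ∀ v ∈ ⋃ f : Fin (n + 1) ↪o Fin (d + 1), (fun t => p.pt (t ∘ f)) '' P.patch 1,
      ∀ᶠ δ in nhdsWithin (0 : ℝ) (Set.Ioi 0), ‖v‖ < δ → v = 0 := by
    intro v _
    by_cases hv : v = 0
    · exact Filter.Eventually.of_forall fun _ _ => hv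
    · filter_upwards [Ioo_mem_nhdsGT (norm_pos_iff.2 hv)] with δ hδ h
      exact absurd h hδ.2.not_gt
  obtain ⟨δ, hδ, h0⟩ := (((Filter.eventually_all_finite hfin).2 h).and
    (Ioo_mem_nhdsGT one_pos)).exists
  refine ⟨δ, h0.1, ?_⟩
  rintro _ ⟨_, ⟨t, ht, f, rfl⟩, rfl⟩ hv
  exact hδ _ (Set.mem_iUnion.2 ⟨f, t, mem_patch ht (pt_comp_mem_cell p ht f) (hv.trans h0.2),
    rfl⟩) hv

/-- If `Q - a` and `Q' - b` agree near the origin, the puncture of `Q'` at `0` gives a puncture of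
`Q` at `a - b`. For short translations the puncture gap of `Q` forces `a = b`, and the translation
can be undone. -/
theorem exists_patch_eq_of_mem_transversal {P Q : SimplicialTiling d} {p : Puncturing d} {n : ℕ}
    (R : ℝ) : ∃ ε : ℝ, 0 < ε ∧ ∀ Q' ∈ P.transversal p n, tilingDist Q Q' < ε →
      Q'.patch R = Q.patch R := by
  obtain ⟨δ, hδ, hgap⟩ := Q.exists_puncture_gap p n
  -- The bounds in turn keep the translations shorter than `1`, leave radius `R` after undoing one,
  -- and bring `a - b` within the gap `δ`.
  obtain ⟨r, hr1, hrR, hrδ⟩ : ∃ r : ℝ, 1 < r ∧ R + 1 ≤ r ∧ 2 * (1 / r) ≤ δ := by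
    refine ⟨2 + max R 0 + 2 / δ, ?_, ?_, ?_⟩
    · have : 0 < 2 / δ := by positivity
      linarith [le_max_right R 0]
    · have : 0 < 2 / δ := by positivity
      linarith [le_max_left R 0]
    · have h0 : 0 < 2 + max R 0 + 2 / δ := by positivity
      rw [mul_one_div, div_le_iff₀ h0]
      have : δ * (2 / δ) = 2 := by field_simp
      nlinarith [le_max_right R 0]
  have hr : 0 < r := by linarith
  refine ⟨1 / (r + 1), by positivity, ?_⟩
  rintro Q' ⟨-, _, ⟨t, ht, f, rfl⟩, h0⟩ hQ'
  obtain ⟨a, b, ha, hb, hab⟩ := exists_patch_eq_of_tilingDist_lt hr hQ'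
  have h1 : 1 / r < 1 := by rw [div_lt_one hr]; exact hr1
  have hbt : -b ∈ cell (shift b t) := by
    rw [cell_shift]
    exact ⟨0, h0 ▸ pt_comp_mem_cell p ht f, by simp⟩
  obtain ⟨u, hu, e⟩ : shift b t ∈ (translate a Q).tiles :=
    mem_tiles_of_patch_eq hab.symm ⟨t, ht, rfl⟩ hbt (by rw [norm_neg]; linarith)
  have hpt : p.pt (u ∘ f) = a - b := by
    have e1 := p.pt_shift ((Q.affineIndependent u hu).comp_embedding f.toEmbedding) a
    have e2 := p.pt_shift ((Q'.affineIndependent t ht).comp_embedding f.toEmbedding) b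
    have e3 : shift a (u ∘ f) = shift b (t ∘ f) := congrArg (· ∘ f) e
    have h0' : p.pt (t ∘ (f.toEmbedding : Fin (n + 1) → Fin (d + 1))) = 0 := h0
    rw [h0'] at e2
    have e4 : p.pt (u ∘ f) - a = 0 - b := e1.symm.trans ((congrArg p.pt e3).trans e2)
    rw [← sub_add_cancel (p.pt (u ∘ f)) a, e4]
    abel
  have hab0 : a - b = 0 := hgap _ ⟨_, ⟨u, hu, f, rfl⟩, hpt⟩
    ((norm_sub_le _ _).trans_lt (by linarith))
  rw [← sub_eq_zero.1 hab0] at hab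
  have := patch_translate (x := -a) (R := R) hab (by rw [norm_neg]; linarith)
  rw [translate_neg_translate, translate_neg_translate] at this
  exact this.symm

/-- Neighborhoods in the transversal are given by patches around the origin. -/
theorem transversal_mem_nhds_iff {P : SimplicialTiling d} {p : Puncturing d} {n : ℕ}
    {Q : P.transversal p n} {U : Set (P.transversal p n)} :
    U ∈ nhds Q ↔ ∃ R : ℝ, 0 < R ∧ ∀ Q' : P.transversal p n,
      Q'.1.patch R = Q.1.patch R → Q' ∈ U := by
  rw [mem_nhds_subtype]
  constructor
  · rintro ⟨V, hV, hVU⟩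
    obtain ⟨ε, hε, hsub⟩ := tiling_mem_nhds_iff.1 hV
    obtain ⟨r, hr, hlt⟩ := exists_one_div_add_one_lt hε
    exact ⟨r, hr, fun Q' h => hVU (hsub _ ((tilingDist_le_of_patch_eq hr h.symm).trans_lt hlt))⟩
  · rintro ⟨R, -, hR⟩
    obtain ⟨ε, hε, h⟩ := exists_patch_eq_of_mem_transversal (P := P) (Q := Q.1) (p := p) (n := n) R
    exact ⟨{Q' | tilingDist Q.1 Q' < ε}, tiling_mem_nhds_iff.2 ⟨ε, hε, fun _ h => h⟩,
      fun Q' hQ' => hR Q' (h _ Q'.2 hQ')⟩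

theorem eventually_patch_eq {P : SimplicialTiling d} {p : Puncturing d} {n : ℕ}
    (Q : P.transversal p n) (R : ℝ) : ∀ᶠ Q' in nhds Q, Q'.1.patch R = Q.1.patch R :=
  transversal_mem_nhds_iff.2 ⟨max R 1, by positivity, fun _ h => patch_congr h (le_max_left _ _)⟩

/-- A translate `P - x` that agrees with `Q` around the origin contains the simplex of `Q` punctured
at `0`. Hence `x` is a puncture of `P` and `P - x` an orbit point. -/
theorem denseRange_orbitPoint (P : SimplicialTiling d) (p : Puncturing d) (n : ℕ) :
    DenseRange (P.orbitPoint p : P.simplices n → P.transversal p n) := by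
  intro Q
  rw [mem_closure_iff_nhds]
  intro U hU
  obtain ⟨R, hR0, hR⟩ := transversal_mem_nhds_iff.1 hU
  obtain ⟨x, hx⟩ := mem_hull_iff.1 Q.2.1 R
  obtain ⟨s, hs, h0⟩ := Q.2.2
  have hs' := mem_simplices_of_patch_eq hx.symm p hs (by rwa [h0, norm_zero])
  have hs'' := shift_mem_simplices (-x) hs'
  rw [translate_neg_translate] at hs''
  have e : (P.orbitPoint p ⟨_, hs''⟩).1 = translate x P := by
    dsimp only [orbitPoint]
    rw [p.pt_shift (simplices_affineIndependent hs), h0, zero_sub, neg_neg]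
  exact ⟨_, hR (P.orbitPoint p ⟨_, hs''⟩) (by rw [e, hx]), _, rfl⟩

/-! ### Simplices with the same neighborhood -/

theorem SameNeighborhood.refl {P : SimplicialTiling d} {n : ℕ} (k : ℕ) (σ : P.simplices n) :
    P.SameNeighborhood k σ σ :=
  ⟨0, (shift_zero _).symm, fun j _ => by simp only [shift_zero, Set.image_id']⟩

theorem SameNeighborhood.symm {P : SimplicialTiling d} {n k : ℕ} {σ σ' : P.simplices n}
    (h : P.SameNeighborhood k σ σ') : P.SameNeighborhood k σ' σ := by
  obtain ⟨x, hx, hj⟩ := h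
  refine ⟨-x, by rw [hx, shift_shift, add_neg_cancel, shift_zero], fun j hjk => ?_⟩
  simp only [hj j hjk, Set.image_image, shift_shift, add_neg_cancel, shift_zero, Set.image_id']

theorem SameNeighborhood.trans {P : SimplicialTiling d} {n k : ℕ} {σ σ' σ'' : P.simplices n}
    (h : P.SameNeighborhood k σ σ') (h' : P.SameNeighborhood k σ' σ'') :
    P.SameNeighborhood k σ σ'' := by
  obtain ⟨x, hx, hj⟩ := h
  obtain ⟨y, hy, hj'⟩ := h'
  refine ⟨x + y, by rw [hy, hx, shift_shift], fun j hjk => ?_⟩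
  simp only [hj' j hjk, hj j hjk, Set.image_image, shift_shift]

theorem SameNeighborhood.mono {P : SimplicialTiling d} {n k k' : ℕ} {σ σ' : P.simplices n}
    (h : P.SameNeighborhood k σ σ') (hk : k' ≤ k) : P.SameNeighborhood k' σ σ' := by
  obtain ⟨x, hx, hj⟩ := h
  exact ⟨x, hx, fun j hjk => hj j (hjk.trans hk)⟩

theorem pt_shift_self {P : SimplicialTiling d} (p : Puncturing d) {n : ℕ} (σ : P.simplices n) :
    p.pt (shift (p.pt σ.1) σ.1) = 0 := by
  rw [p.pt_shift (simplices_affineIndependent σ.2), sub_self]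

/-- Simplices with patches that agree up to a large radius have the same neighborhoods. -/
theorem exists_nhds_sameNeighborhood (P : SimplicialTiling d) (p : Puncturing d) {n : ℕ} (k : ℕ)
    (Q : P.transversal p n) : ∃ V ∈ nhds Q, ∀ σ σ' : P.simplices n, P.orbitPoint p σ ∈ V →
      P.orbitPoint p σ' ∈ V → P.SameNeighborhood k σ σ' := by
  obtain ⟨L, hL0, hL⟩ := P.exists_dist_le
  refine ⟨_, eventually_patch_eq Q ((k + 1) * L + 1), fun σ σ' h h' => ?_⟩
  have hpatch : (translate (p.pt σ.1) P).patch ((k + 1) * L + 1) =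
      (translate (p.pt σ'.1) P).patch ((k + 1) * L + 1) := Eq.trans h (Eq.symm h')
  have hs := shift_mem_simplices (p.pt σ.1) σ.2
  have hs' := shift_mem_simplices (p.pt σ'.1) σ'.2
  have h0 := pt_shift_self p σ
  have hR : 0 < (k + 1) * L + 1 := by positivity
  have e : shift (p.pt σ.1) σ.1 = shift (p.pt σ'.1) σ'.1 :=
    eq_of_pt_eq p (mem_simplices_of_patch_eq hpatch p hs (by rwa [h0, norm_zero])) hs'
      (h0.trans (pt_shift_self p σ').symm)
  have hcell : (0 : Euc d) ∈ cell (shift (p.pt σ.1) σ.1) := by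
    have := p.pt_mem_cell (simplices_affineIndependent hs)
    rwa [h0] at this
  refine ⟨p.pt σ.1 - p.pt σ'.1, ?_, fun j hj => ?_⟩
  · have := congrArg (shift (-(p.pt σ'.1))) e
    rw [shift_shift, shift_shift, add_neg_cancel, shift_zero, ← sub_eq_add_neg] at this
    exact this.symm
  · have hjk : (j : ℝ) ≤ k := Nat.cast_le.2 hj
    have h1 := neighborhood_congr hL0 (dist_le_translate hL _) (dist_le_translate hL _) hpatch
      hcell j (by nlinarith)
    rw [neighborhood_translate, e, neighborhood_translate] at h1
    have := congrArg (fun S => shift (-(p.pt σ'.1)) '' S) h1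
    simp only [Set.image_image, shift_shift, add_neg_cancel, shift_zero, Set.image_id'] at this
    rw [sub_eq_add_neg]
    exact this.symm

theorem exists_patch_eq_of_sameNeighborhood (P : SimplicialTiling d) (p : Puncturing d) (n : ℕ)
    (R : ℝ) : ∃ k : ℕ, ∀ σ σ' : P.simplices n, P.SameNeighborhood k σ σ' →
      (translate (p.pt σ.1) P).patch R = (translate (p.pt σ'.1) P).patch R := by
  obtain ⟨k, hk⟩ := P.exists_neighborhood_covers R
  have key : ∀ σ σ' : P.simplices n, P.SameNeighborhood k σ σ' →
      (translate (p.pt σ.1) P).patch R ⊆ (translate (p.pt σ'.1) P).patch R := by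
    rintro σ σ' ⟨x, hx, hj⟩ _ ⟨⟨t, ht, rfl⟩, w, hwt, hw⟩
    refine ⟨?_, w, hwt, hw⟩
    have hA := simplices_affineIndependent σ.2
    rw [cell_shift] at hwt
    obtain ⟨w, hwt, rfl⟩ := hwt
    have ht' : t ∈ P.neighborhood σ.1 k := by
      refine hk n σ.1 σ.2 (p.pt σ.1) (p.pt_mem_cell hA) t ht ⟨w, hwt, ?_⟩
      rwa [Metric.mem_ball, dist_eq_norm, ← mem_ball_zero_iff]
    have ht'' : shift x t ∈ P.neighborhood σ'.1 k := by
      rw [hj k le_rfl]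
      exact ⟨t, ht', rfl⟩
    refine ⟨_, P.neighborhood_subset_tiles _ _ ht'', ?_⟩
    rw [shift_shift, hx, p.pt_shift hA, add_sub_cancel]
  exact ⟨k, fun σ σ' h => (key σ σ' h).antisymm (key σ' σ h.symm)⟩

/-! ### Limits of tilings -/

section Limit

variable {ι : Type*} (U : Ultrafilter ι) (T : ι → SimplicialTiling d)

/-- The ultrafilter decides for each tile whether it eventually occurs; since the patches of radius
`R` involve only the finitely many tiles of `G`, all decisions hold simultaneously. -/
theorem eventually_patch_eq_limit
    (hG : ∀ R : ℝ, ∃ G : Set (Fin (d + 1) → Euc d), G.Finite ∧ ∀ i, (T i).patch R ⊆ G) (R : ℝ) :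
    ∀ᶠ i in (U : Filter ι), (T i).patch R =
      {t | (∀ᶠ i in (U : Filter ι), t ∈ (T i).tiles) ∧ (cell t ∩ Metric.ball 0 R).Nonempty} := by
  obtain ⟨G, hGf, hGT⟩ := hG R
  have h : ∀ t ∈ G, ∀ᶠ i in (U : Filter ι),
      (t ∈ (T i).tiles ↔ ∀ᶠ i in (U : Filter ι), t ∈ (T i).tiles) := by
    intro t _
    by_cases ht : ∀ᶠ i in (U : Filter ι), t ∈ (T i).tiles
    · filter_upwards [ht] with i hi
      exact ⟨fun _ => ht, fun _ => hi⟩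
    · filter_upwards [Ultrafilter.eventually_not.2 ht] with i hi
      exact ⟨fun h => absurd h hi, fun h => absurd h ht⟩
  filter_upwards [(Filter.eventually_all_finite hGf).2 h] with i hi
  ext t
  constructor
  · intro ht
    exact ⟨(hi t (hGT i ht)).1 ht.1, ht.2⟩
  · rintro ⟨ht, hne⟩
    obtain ⟨j, hj⟩ := ht.exists
    exact ⟨(hi t (hGT j ⟨hj, hne⟩)).2 ht, hne⟩

theorem eventually_mem_of_limit {t t' : Fin (d + 1) → Euc d}
    (ht : ∀ᶠ i in (U : Filter ι), t ∈ (T i).tiles)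
    (ht' : ∀ᶠ i in (U : Filter ι), t' ∈ (T i).tiles) : ∃ i, t ∈ (T i).tiles ∧ t' ∈ (T i).tiles :=
  (ht.and ht').exists

/-- The limit of tilings along an ultrafilter: its tiles are those that eventually occur. -/
def ultralimit (F : Set (Fin (d + 1) → Euc d)) (hF : F.Finite)
    (hFT : ∀ i, ∀ t ∈ (T i).tiles, ∃ q ∈ F, ∃ x : Euc d, t = shift x q)
    (hG : ∀ R : ℝ, ∃ G : Set (Fin (d + 1) → Euc d), G.Finite ∧ ∀ i, (T i).patch R ⊆ G) :
    SimplicialTiling d where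
  tiles := {t | ∀ᶠ i in (U : Filter ι), t ∈ (T i).tiles}
  affineIndependent t ht := by
    obtain ⟨i, hi, -⟩ := eventually_mem_of_limit U T ht ht
    exact (T i).affineIndependent t hi
  -- The other tiling axioms involve at most two given tiles and pass to the limit directly;
  -- covering needs the patches to stabilize.
  cover v := by
    obtain ⟨i, hi⟩ := (eventually_patch_eq_limit U T hG (‖v‖ + 1)).exists
    obtain ⟨t, ht, hv⟩ := (T i).cover v
    have := mem_patch ht hv (lt_add_one _)
    rw [hi] at this
    exact ⟨t, this.1, hv⟩
  face_to_face t ht t' ht' := by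
    obtain ⟨i, hi, hi'⟩ := eventually_mem_of_limit U T ht ht'
    exact (T i).face_to_face t hi t' hi'
  order_compat t ht t' ht' := by
    obtain ⟨i, hi, hi'⟩ := eventually_mem_of_limit U T ht ht'
    exact (T i).order_compat t hi t' hi'
  equivariant t ht t' ht' := by
    obtain ⟨i, hi, hi'⟩ := eventually_mem_of_limit U T ht ht'
    exact (T i).equivariant t hi t' hi'
  finite_prototiles := ⟨F, hF, fun t ht => by
    obtain ⟨i, hi, -⟩ := eventually_mem_of_limit U T ht ht
    exact hFT i t hi⟩

end Limit

/-- The orbit points have limits in the transversal along every ultrafilter. -/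
theorem exists_limit_orbitPoint {P : SimplicialTiling d} (p : Puncturing d) {n : ℕ} {ι : Type*}
    (U : Ultrafilter ι) (σ : ι → P.simplices n) : ∃ Q : P.transversal p n, ∀ R : ℝ,
      ∀ᶠ i in (U : Filter ι), (P.orbitPoint p (σ i)).1.patch R = Q.1.patch R := by
  obtain ⟨F, hF, hFt⟩ := P.finite_prototiles
  let T : ι → SimplicialTiling d := fun i => translate (p.pt (σ i).1) P
  have hFT : ∀ i, ∀ t ∈ (T i).tiles, ∃ q ∈ F, ∃ x : Euc d, t = shift x q := by
    rintro i _ ⟨t, ht, rfl⟩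
    obtain ⟨q, hq, x, rfl⟩ := hFt t ht
    exact ⟨q, hq, _, shift_shift _ _ _⟩
  have hG : ∀ R : ℝ, ∃ G : Set (Fin (d + 1) → Euc d), G.Finite ∧ ∀ i, (T i).patch R ⊆ G := by
    intro R
    obtain ⟨G, hG, h⟩ := P.exists_finite_patches p n R
    exact ⟨G, hG, fun i => h (σ i)⟩
  have hlim : ∀ R : ℝ, ∀ᶠ i in (U : Filter ι),
      (T i).patch R = (ultralimit U T F hF hFT hG).patch R := eventually_patch_eq_limit U T hG
  refine ⟨⟨ultralimit U T F hF hFT hG, ?_, ?_⟩, hlim⟩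
  · refine mem_hull_iff.2 fun R => ?_
    obtain ⟨i, hi⟩ := (hlim R).exists
    exact ⟨_, hi⟩
  · obtain ⟨i, hi⟩ := (hlim 1).exists
    have h0 := pt_shift_self p (σ i)
    exact ⟨_, mem_simplices_of_patch_eq hi p (shift_mem_simplices _ (σ i).2)
      (by rw [h0, norm_zero]; exact one_pos), h0⟩

/-- Given a neighborhood of every point of the transversal, the orbit points of two simplices with
the same sufficiently large neighborhood lie in a common one of these. -/
theorem exists_sameNeighborhood_subordinate (P : SimplicialTiling d) (p : Puncturing d) {n : ℕ}
    (V : P.transversal p n → Set (P.transversal p n)) (hV : ∀ Q, V Q ∈ nhds Q) :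
    ∃ k : ℕ, ∀ σ σ' : P.simplices n, P.SameNeighborhood k σ σ' →
      ∃ Q, P.orbitPoint p σ ∈ V Q ∧ P.orbitPoint p σ' ∈ V Q := by
  by_contra! hcon
  choose σ σ' hsame hnot using hcon
  -- Counterexamples for all `k` have a limit `Q`. For suitable large `k`, the points of `σ k` and
  -- `σ' k` share the patch of `Q` of radius `R`, so both lie in `V Q`.
  obtain ⟨Q, hQ⟩ := exists_limit_orbitPoint p (Filter.hyperfilter ℕ) σ
  obtain ⟨R, -, hR⟩ := transversal_mem_nhds_iff.1 (hV Q)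
  obtain ⟨k₀, hk₀⟩ := P.exists_patch_eq_of_sameNeighborhood p n R
  obtain ⟨k, hk, hkk⟩ := ((hQ R).and
    (Nat.hyperfilter_le_atTop (Filter.eventually_ge_atTop k₀))).exists
  refine hnot k Q (hR _ hk) (hR _ ?_)
  exact (hk₀ _ _ ((hsame k).mono hkk)).symm.trans hk

end SimplicialTiling

/-! ### Isomorphisms of complexes and cohomology -/

section Cohomology

variable {C C' : ℕ → Type*} [∀ n, AddCommGroup (C n)] [∀ n, AddCommGroup (C' n)]
  {D : ∀ n, C n →+ C (n + 1)} {D' : ∀ n, C' n →+ C' (n + 1)}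
  {S : ∀ n, AddSubgroup (C n)} {S' : ∀ n, AddSubgroup (C' n)}

theorem map_mem_cocycles_iff (hS : IsComplex D S) (φ : ∀ n, S n ≃+ S' n)
    (hφ : ∀ n (c : S n), (φ (n + 1) ⟨D n c.1, hS.1 n c.1 c.2⟩).1 = D' n (φ n c).1) {n : ℕ}
    (c : S n) : (φ n c).1 ∈ cocycles D' S' n ↔ c.1 ∈ cocycles D S n := by
  have h : D' n (φ n c).1 = 0 ↔ D n c.1 = 0 := by
    rw [← hφ, ZeroMemClass.coe_eq_zero, EmbeddingLike.map_eq_zero_iff, ← ZeroMemClass.coe_eq_zero]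
  exact ⟨fun hc => ⟨c.2, h.1 hc.2⟩, fun hc => ⟨(φ n c).2, h.2 hc.2⟩⟩

theorem map_mem_coboundaries_iff (hS : IsComplex D S) (φ : ∀ n, S n ≃+ S' n)
    (hφ : ∀ n (c : S n), (φ (n + 1) ⟨D n c.1, hS.1 n c.1 c.2⟩).1 = D' n (φ n c).1) {n : ℕ}
    (c : S n) : (φ n c).1 ∈ coboundaries D' S' n ↔ c.1 ∈ coboundaries D S n := by
  cases n with
  | zero =>
    change (φ 0 c).1 = 0 ↔ c.1 = 0
    rw [ZeroMemClass.coe_eq_zero, EmbeddingLike.map_eq_zero_iff, ZeroMemClass.coe_eq_zero]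
  | succ n =>
    constructor
    · rintro ⟨b', hb', h⟩
      refine ⟨((φ n).symm ⟨b', hb'⟩).1, ((φ n).symm ⟨b', hb'⟩).2, ?_⟩
      have h1 := hφ n ((φ n).symm ⟨b', hb'⟩)
      rw [AddEquiv.apply_symm_apply] at h1
      exact congrArg Subtype.val ((φ (n + 1)).injective (Subtype.ext (h1.trans h)))
    · rintro ⟨b, hb, h⟩
      refine ⟨(φ n ⟨b, hb⟩).1, (φ n ⟨b, hb⟩).2, (hφ n ⟨b, hb⟩).symm.trans ?_⟩
      exact congrArg (fun c => (φ (n + 1) c).1) (Subtype.ext h)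

/-- An isomorphism of complexes restricts to an isomorphism of cocycles. -/
def cocyclesEquiv (hS : IsComplex D S) (φ : ∀ n, S n ≃+ S' n)
    (hφ : ∀ n (c : S n), (φ (n + 1) ⟨D n c.1, hS.1 n c.1 c.2⟩).1 = D' n (φ n c).1) (n : ℕ) :
    cocycles D S n ≃+ cocycles D' S' n where
  toFun c := ⟨(φ n ⟨c.1, c.2.1⟩).1, (map_mem_cocycles_iff hS φ hφ _).2 c.2⟩
  invFun c := ⟨((φ n).symm ⟨c.1, c.2.1⟩).1, (map_mem_cocycles_iff hS φ hφ _).1 (by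
    rw [AddEquiv.apply_symm_apply]; exact c.2)⟩
  left_inv c := by simp
  right_inv c := by simp
  map_add' c c' := by
    have h := congrArg Subtype.val (map_add (φ n) ⟨c.1, c.2.1⟩ ⟨c'.1, c'.2.1⟩)
    exact Subtype.ext h

/-- An isomorphism of complexes induces an isomorphism in cohomology. -/
theorem exists_cohomology_equiv (hS : IsComplex D S) (φ : ∀ n, S n ≃+ S' n)
    (hφ : ∀ n (c : S n), (φ (n + 1) ⟨D n c.1, hS.1 n c.1 c.2⟩).1 = D' n (φ n c).1) :
    ∃ Φ : ∀ n, Cohomology D S n ≃+ Cohomology D' S' n,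
      ∀ n c (hc : c ∈ cocycles D S n), ∃ h : (φ n ⟨c, hc.1⟩).1 ∈ cocycles D' S' n,
        Φ n (cohomologyClass c hc) = cohomologyClass _ h := by
  refine ⟨fun n => QuotientAddGroup.congr _ _ (cocyclesEquiv hS φ hφ n) ?_,
    fun n c hc => ⟨(map_mem_cocycles_iff hS φ hφ _).2 hc, rfl⟩⟩
  ext c'
  change c' ∈ AddSubgroup.map (cocyclesEquiv hS φ hφ n).toAddMonoidHom _ ↔ _
  rw [AddSubgroup.mem_map_equiv, AddSubgroup.mem_addSubgroupOf, AddSubgroup.mem_addSubgroupOf]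
  have h := map_mem_coboundaries_iff hS φ hφ (n := n) ((φ n).symm ⟨c'.1, c'.2.1⟩)
  rw [AddEquiv.apply_symm_apply] at h
  exact h.symm

end Cohomology

namespace SimplicialTiling

variable {d : ℕ}

/-! ### The PV differential -/

/-- Membership is witnessed by one tile that contains the origin. This makes acceptance zones clopen
in the transversal. -/
theorem mem_acceptanceZone_of_patch_eq {P Q Q' : SimplicialTiling d} {p : Puncturing d} {n : ℕ}
    {τ : P.ProtoSimplex n} (hQ' : Q' ∈ P.hull) (h : Q'.patch 1 = Q.patch 1)
    (hQ : Q ∈ P.acceptanceZone p τ) : Q' ∈ P.acceptanceZone p τ := by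
  obtain ⟨-, t, ht, f, h0, hx⟩ := hQ
  exact ⟨hQ', t, mem_tiles_of_patch_eq h.symm ht (h0 ▸ pt_comp_mem_cell p ht f)
    (by rw [norm_zero]; exact one_pos), f, h0, hx⟩

theorem isClopen_acceptanceZone (P : SimplicialTiling d) (p : Puncturing d) {n : ℕ}
    (τ : P.ProtoSimplex n) :
    IsClopen {ξ : P.transversal p n | ξ.1 ∈ P.acceptanceZone p τ} := by
  constructor
  · rw [← isOpen_compl_iff, isOpen_iff_mem_nhds]
    intro Q hQ
    filter_upwards [eventually_patch_eq Q 1] with Q' h h'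
    exact hQ (mem_acceptanceZone_of_patch_eq Q.2.1 h.symm h')
  · rw [isOpen_iff_mem_nhds]
    intro Q hQ
    filter_upwards [eventually_patch_eq Q 1] with Q' h
    exact mem_acceptanceZone_of_patch_eq Q'.2.1 h hQ

/-- An `n`-simplex is determined by its puncture, so the one at `0` in `P - p_σ` can only be the
translate of `σ`. -/
theorem mem_acceptanceZone_orbitPoint {P : SimplicialTiling d} {p : Puncturing d} {n : ℕ}
    (σ : P.simplices n) (τ : P.ProtoSimplex n) :
    (P.orbitPoint p σ).1 ∈ P.acceptanceZone p τ ↔ τ = Quot.mk _ σ := by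
  constructor
  · rintro ⟨-, _, ⟨t, ht, rfl⟩, f, h0, x, hx, hτ⟩
    have e : shift (p.pt σ.1) t ∘ f = shift (p.pt σ.1) σ.1 :=
      eq_of_pt_eq (P := translate (p.pt σ.1) P) p ⟨_, ⟨t, ht, rfl⟩, f, rfl⟩
        (shift_mem_simplices _ σ.2) (h0.trans (pt_shift_self p σ).symm)
    have e' : σ.1 = t ∘ f := (shift_injective _ e).symm
    rw [← hτ]
    exact (Quot.sound ⟨t, ht, p.pt σ.1 + x, by rw [← shift_shift]; exact hx, f, e', by
      rw [← shift_shift]⟩).symm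
  · rintro rfl
    obtain ⟨s, t, ht, f, rfl⟩ := σ
    refine ⟨(P.orbitPoint p _).2.1, _, ⟨t, ht, rfl⟩, f, pt_shift_self p ⟨_, t, ht, f, rfl⟩,
      -p.pt (t ∘ f), ?_, ?_⟩
    · rw [shift_shift, add_neg_cancel, shift_zero]
      exact ht
    · have e : shift (-p.pt (t ∘ f)) (shift (p.pt (t ∘ f)) t) = t := by
        rw [shift_shift, add_neg_cancel, shift_zero]
      exact congrArg (Quot.mk _) (Subtype.ext (congrArg (· ∘ f) e))

/-- Simplices of one class are translates of each other, so the face vector does not depend on the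
representative and may be computed from `σ`. -/
theorem translate_faceVector_orbitPoint {P : SimplicialTiling d} {p : Puncturing d} {n : ℕ}
    (σ : P.simplices (n + 1)) (i : Fin (n + 2)) :
    translate (P.faceVector p (Quot.mk _ σ) i) (P.orbitPoint p σ).1 =
      (P.orbitPoint p (face i σ)).1 := by
  obtain ⟨y, hy⟩ := exists_shift_of_mk_eq (Quot.out_eq (Quot.mk (P.ProtoRel (n + 1)) σ)).symm
  have e1 := p.pt_shift (simplices_affineIndependent σ.2) y
  have e2 := p.pt_shift (simplices_affineIndependent (face i σ).2) y
  have e3 : (face i (Quot.out (Quot.mk (P.ProtoRel (n + 1)) σ))).1 = shift y (face i σ).1 := by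
    simp only [face, hy]; rfl
  have e4 : P.faceVector p (Quot.mk _ σ) i = p.pt (face i σ).1 - p.pt σ.1 := by
    change p.pt (face i (Quot.out (Quot.mk (P.ProtoRel (n + 1)) σ))).1 -
      p.pt (Quot.out (Quot.mk (P.ProtoRel (n + 1)) σ)).1 = _
    rw [e3, e2, hy, e1, sub_sub_sub_cancel_right]
  dsimp only [orbitPoint]
  rw [translate_translate, e4, add_sub_cancel]

/-- The acceptance zone is clopen, so extension by zero preserves continuity. -/
theorem continuous_theta {A : Type*} [AddCommGroup A] [TopologicalSpace A]
    {P : SimplicialTiling d} {p : Puncturing d} {n : ℕ} (τ : P.ProtoSimplex (n + 1))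
    (i : Fin (n + 2)) {f : P.transversal p n → A} (hf : Continuous f) :
    Continuous (P.theta p τ i f) := by
  have hZ := P.isClopen_acceptanceZone p τ
  have h1 : ContinuousOn (P.theta p τ i f) {ξ | ξ.1 ∈ P.acceptanceZone p τ} := by
    rw [continuousOn_iff_continuous_domRestrict]
    have hg : Continuous fun ξ : {ξ : P.transversal p (n + 1) | ξ.1 ∈ P.acceptanceZone p τ} =>
        f ⟨translate (P.faceVector p τ i) ξ.1.1, translate_mem_transversal i ξ.2⟩ :=
      hf.comp (((continuous_translate _).comp
        (continuous_subtype_val.comp continuous_subtype_val)).subtype_mk _)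
    convert hg using 2 with ξ
    exact dif_pos ξ.2
  refine continuous_iff_continuousAt.2 fun ξ => ?_
  by_cases hξ : ξ.1 ∈ P.acceptanceZone p τ
  · exact h1.continuousAt (hZ.isOpen.mem_nhds hξ)
  · refine (continuousAt_const (y := (0 : A))).congr ?_
    filter_upwards [hZ.compl.isOpen.mem_nhds hξ] with ξ' hξ'
    have h0 : P.theta p τ i f ξ' = 0 := dif_neg hξ'
    exact h0.symm

theorem dPV_apply {A : Type*} [AddCommGroup A] (P : SimplicialTiling d) (p : Puncturing d) {n : ℕ}
    [hτ : Fintype (P.ProtoSimplex (n + 1))] (f : P.transversal p n → A)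
    (ξ : P.transversal p (n + 1)) : P.dPV A p n f ξ =
      ∑ τ : P.ProtoSimplex (n + 1), ∑ i : Fin (n + 2),
        ((-1 : ℤ) ^ (i : ℕ)) • P.theta p τ i f ξ := by
  rw [Subsingleton.elim hτ (Fintype.ofFinite _)]
  simp [dPV, Finset.sum_apply]

theorem continuous_dPV {A : Type*} [AddCommGroup A] [TopologicalSpace A] [IsTopologicalAddGroup A]
    {P : SimplicialTiling d} {p : Puncturing d} {n : ℕ} {f : P.transversal p n → A}
    (hf : Continuous f) : Continuous (P.dPV A p n f) := by
  let := Fintype.ofFinite (P.ProtoSimplex (n + 1))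
  have e : P.dPV A p n f = fun ξ => ∑ τ : P.ProtoSimplex (n + 1), ∑ i : Fin (n + 2),
      ((-1 : ℤ) ^ (i : ℕ)) • P.theta p τ i f ξ := funext fun ξ => dPV_apply P p f ξ
  rw [e]
  exact continuous_finsetSum _ fun τ _ => continuous_finsetSum _ fun i _ =>
    (continuous_theta τ i hf).zsmul _

theorem isLocallyConstant_dPV {A : Type*} [AddCommGroup A] {P : SimplicialTiling d}
    {p : Puncturing d} {n : ℕ} {f : P.transversal p n → A} (hf : IsLocallyConstant f) :
    IsLocallyConstant (P.dPV A p n f) := by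
  let : TopologicalSpace A := ⊥
  have : DiscreteTopology A := ⟨rfl⟩
  exact (IsLocallyConstant.iff_continuous _).2 (continuous_dPV hf.continuous)

/-- The values of a function on the transversal at the orbit points, as a simplicial cochain. -/
def orbitRestrict (A : Type*) [AddCommGroup A] (P : SimplicialTiling d) (p : Puncturing d) (n : ℕ) :
    (P.transversal p n → A) →+ (P.simplices n → A) where
  toFun f σ := f (P.orbitPoint p σ)
  map_zero' := rfl
  map_add' _ _ := rfl

theorem orbitRestrict_dPV {A : Type*} [AddCommGroup A] (P : SimplicialTiling d) (p : Puncturing d)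
    (n : ℕ) (f : P.transversal p n → A) :
    P.orbitRestrict A p (n + 1) (P.dPV A p n f) = P.dS A n (P.orbitRestrict A p n f) := by
  let := Fintype.ofFinite (P.ProtoSimplex (n + 1))
  funext σ
  change P.dPV A p n f (P.orbitPoint p σ) =
    ∑ i : Fin (n + 2), ((-1 : ℤ) ^ (i : ℕ)) • f (P.orbitPoint p (face i σ))
  rw [dPV_apply]
  refine (Finset.sum_eq_single (Quot.mk _ σ : P.ProtoSimplex (n + 1)) ?_ ?_).trans ?_
  rotate_left 2
  · refine Finset.sum_congr rfl fun i _ => ?_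
    congr 1
    refine (dif_pos ((mem_acceptanceZone_orbitPoint σ _).2 rfl)).trans (congrArg f ?_)
    exact Subtype.ext (translate_faceVector_orbitPoint σ i)
  · intro τ _ hτ
    refine Finset.sum_eq_zero fun i _ => ?_
    have : P.theta p τ i f (P.orbitPoint p σ) = 0 :=
      dif_neg (mt (mem_acceptanceZone_orbitPoint σ τ).1 hτ)
    rw [this, smul_zero]
  · exact fun h => absurd (Finset.mem_univ (α := P.ProtoSimplex (n + 1)) (Quot.mk _ σ)) h

theorem face_face {P : SimplicialTiling d} {n : ℕ} (i : Fin (n + 3)) (j : Fin (n + 2))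
    (σ : P.simplices (n + 2)) :
    face (j.predAbove i) (face (i.succAbove j) σ) = face j (face i σ) := by
  refine Subtype.ext (funext fun k => ?_)
  exact congrArg σ.1 (Fin.succAbove_succAbove_succAbove_predAbove i j k)

theorem dS_dS {A : Type*} [AddCommGroup A] (P : SimplicialTiling d) (n : ℕ)
    (c : P.simplices n → A) : P.dS A (n + 1) (P.dS A n c) = 0 := by
  funext σ
  change ∑ i : Fin (n + 3), ((-1 : ℤ) ^ (i : ℕ)) •
    ∑ j : Fin (n + 2), ((-1 : ℤ) ^ (j : ℕ)) • c (face j (face i σ)) = 0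
  simp only [Finset.smul_sum, smul_smul, ← pow_add]
  rw [← Finset.sum_product']
  -- The involution exchanges the two orders in which the same pair of vertices can be removed; the
  -- signs are opposite.
  refine Finset.sum_involution (fun a _ => (a.1.succAbove a.2, a.2.predAbove a.1)) ?_ ?_ ?_ ?_
  · rintro ⟨i, j⟩ -
    dsimp only
    rw [face_face, Fin.neg_one_pow_succAbove_add_predAbove, neg_smul, add_neg_cancel]
  · rintro ⟨i, j⟩ - - h
    exact Fin.succAbove_ne i j (congrArg Prod.fst h)
  · exact fun _ _ => Finset.mem_univ _
  · rintro ⟨i, j⟩ -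
    exact Prod.ext (Fin.succAbove_succAbove_predAbove i j) (Fin.predAbove_predAbove_succAbove i j)

/-! ### Pattern equivariant cochains and functions on the transversal -/

theorem eq_of_orbitRestrict_eq {A : Type*} [AddCommGroup A] [TopologicalSpace A] [T2Space A]
    {P : SimplicialTiling d} {p : Puncturing d} {n : ℕ} {f g : P.transversal p n → A}
    (hf : Continuous f) (hg : Continuous g)
    (h : P.orbitRestrict A p n f = P.orbitRestrict A p n g) : f = g :=
  (P.denseRange_orbitPoint p n).equalizer hf hg h

theorem eq_of_orbitRestrict_eq_of_isLocallyConstant {A : Type*} [AddCommGroup A]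
    {P : SimplicialTiling d} {p : Puncturing d} {n : ℕ} {f g : P.transversal p n → A}
    (hf : IsLocallyConstant f) (hg : IsLocallyConstant g)
    (h : P.orbitRestrict A p n f = P.orbitRestrict A p n g) : f = g := by
  let : TopologicalSpace A := ⊥
  have : DiscreteTopology A := ⟨rfl⟩
  exact eq_of_orbitRestrict_eq hf.continuous hg.continuous h

/-- Compactness enters here: one `k` serves the neighborhoods of all points on which `f` is
constant. -/
theorem orbitRestrict_mem_strongPE {A : Type*} [AddCommGroup A] {P : SimplicialTiling d}
    {p : Puncturing d} {n : ℕ} {f : P.transversal p n → A} (hf : IsLocallyConstant f) :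
    P.orbitRestrict A p n f ∈ P.strongPE A n := by
  obtain ⟨k, hk⟩ := P.exists_sameNeighborhood_subordinate p (fun Q => {Q' | f Q' = f Q})
    hf.eventually_eq
  refine ⟨k, fun σ σ' h => ?_⟩
  obtain ⟨Q, hQ, hQ'⟩ := hk σ σ' h
  exact Eq.trans hQ (Eq.symm hQ')

theorem exists_orbitRestrict_eq_of_strongPE {A : Type*} [AddCommGroup A] {P : SimplicialTiling d}
    (p : Puncturing d) {n : ℕ} {c : P.simplices n → A} (hc : c ∈ P.strongPE A n) :
    ∃ f : P.transversal p n → A, IsLocallyConstant f ∧ P.orbitRestrict A p n f = c := by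
  obtain ⟨k, hk⟩ := hc
  choose V hV hsame using P.exists_nhds_sameNeighborhood p (n := n) k
  have hdense : ∀ {Q : P.transversal p n} {W : Set (P.transversal p n)}, W ∈ nhds Q →
      ∃ σ, P.orbitPoint p σ ∈ W := fun {Q W} hW => by
    obtain ⟨_, hQ', σ, rfl⟩ := mem_closure_iff_nhds.1 (P.denseRange_orbitPoint p n Q) W hW
    exact ⟨σ, hQ'⟩
  -- All orbit points in `V Q` carry the same value of `c`, so the choice of `s Q` does not affect
  -- the extension.
  choose s hs using fun Q => hdense (hV Q)
  have hcV : ∀ Q σ, P.orbitPoint p σ ∈ V Q → c (s Q) = c σ := fun Q σ hσ =>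
    hk _ _ (hsame Q _ _ (hs Q) hσ)
  refine ⟨fun Q => c (s Q), (IsLocallyConstant.iff_eventually_eq _).2 fun Q => ?_,
    funext fun σ => hcV _ σ (mem_of_mem_nhds (hV _))⟩
  filter_upwards [eventually_mem_nhds_iff.2 (hV Q)] with Q' hQ'
  -- An orbit point in both `V Q` and `V Q'` links the two values.
  obtain ⟨σ, h, h'⟩ := hdense (Filter.inter_mem hQ' (hV Q'))
  exact (hcV Q' σ h').trans (hcV Q σ h).symm

/-! ### Uniform approximation and the weak case -/

theorem supEDist_orbitRestrict {A : Type*} [AddCommGroup A] [MetricSpace A]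
    {P : SimplicialTiling d} {p : Puncturing d} {n : ℕ} {f g : P.transversal p n → A}
    (hf : Continuous f) (hg : Continuous g) :
    supEDist (P.orbitRestrict A p n f) (P.orbitRestrict A p n g) = supEDist f g := by
  refine le_antisymm (iSup_le fun σ => le_iSup (fun Q => edist (f Q) (g Q)) (P.orbitPoint p σ))
    (iSup_le fun Q => ?_)
  refine (P.denseRange_orbitPoint p n).induction_on Q
    (isClosed_le (hf.edist hg) continuous_const) fun σ => ?_
  exact le_iSup (fun σ => edist (P.orbitRestrict A p n f σ) (P.orbitRestrict A p n g σ)) σ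

theorem exists_strongPE_supEDist_lt {A : Type*} [AddCommGroup A] [MetricSpace A]
    {P : SimplicialTiling d} {p : Puncturing d} {n : ℕ} {f : P.transversal p n → A}
    (hf : Continuous f) {ε : ℝ≥0∞} (hε : 0 < ε) :
    ∃ c ∈ P.strongPE A n, supEDist (P.orbitRestrict A p n f) c < ε := by
  obtain ⟨ε', hε', hlt⟩ := exists_between hε
  obtain ⟨k, hk⟩ := P.exists_sameNeighborhood_subordinate p
    (fun Q => {Q' | edist (f Q') (f Q) < ε' / 2})
    (fun Q => hf.continuousAt (Metric.eball_mem_nhds (f Q) (ENNReal.half_pos hε'.ne')))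
  -- Replacing each value by that at a chosen representative of its `k`-neighborhood class gives an
  -- s-PE cochain. Both values lie within `ε' / 2` of a common `f Q`.
  let S : Setoid (P.simplices n) := ⟨P.SameNeighborhood k, SameNeighborhood.refl k,
    SameNeighborhood.symm, SameNeighborhood.trans⟩
  refine ⟨fun σ => P.orbitRestrict A p n f (Quotient.out (s := S) ⟦σ⟧), ⟨k, fun σ σ' h => ?_⟩,
    lt_of_le_of_lt (iSup_le fun σ => ?_) hlt⟩
  · have e : (⟦σ⟧ : Quotient S) = ⟦σ'⟧ := Quotient.sound h
    dsimp only
    rw [e]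
  · obtain ⟨Q, h1, h2⟩ := hk _ σ (Quotient.mk_out (s := S) σ)
    refine (edist_triangle_right _ _ (f Q)).trans ?_
    rw [← ENNReal.add_halves ε']
    exact add_le_add (le_of_lt h2) (le_of_lt h1)

theorem isBounded_of_supEDist_lt {X A : Type*} [PseudoMetricSpace A] {f g : X → A}
    (h : supEDist f g < 1) (hg : Bornology.IsBounded (Set.range g)) :
    Bornology.IsBounded (Set.range f) := by
  refine (hg.cthickening (δ := 1)).subset ?_
  rintro _ ⟨x, rfl⟩
  refine Metric.mem_cthickening_of_dist_le _ (g x) _ _ ⟨x, rfl⟩ ?_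
  have := (le_iSup (fun x => edist (f x) (g x)) x).trans h.le
  rw [edist_dist, ENNReal.ofReal_le_one] at this
  exact this

section WeakPE

variable {A : Type*} [AddCommGroup A] [MetricSpace A] [CompleteSpace A] [IsTopologicalAddGroup A]

/-- Boundedness also comes from the approximation, since s-PE cochains take only finitely many
values. -/
theorem orbitRestrict_mem_weakPE {P : SimplicialTiling d} {p : Puncturing d} {n : ℕ}
    {f : P.transversal p n → A} (hf : Continuous f) :
    P.orbitRestrict A p n f ∈ P.weakPE A n := by
  refine ⟨?_, fun ε hε => exists_strongPE_supEDist_lt hf hε⟩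
  obtain ⟨c, hc, h⟩ := exists_strongPE_supEDist_lt hf one_pos
  exact isBounded_of_supEDist_lt h (strongPE_finite_range hc).isBounded

theorem exists_orbitRestrict_eq_of_weakPE {P : SimplicialTiling d} (p : Puncturing d) {n : ℕ}
    {c : P.simplices n → A} (hc : c ∈ P.weakPE A n) :
    ∃ f : P.transversal p n → A, Continuous f ∧ P.orbitRestrict A p n f = c := by
  -- Several simplices may have the same orbit point if `P` has periods, so the orbit map is made
  -- dense inducing, not an embedding.
  let : TopologicalSpace (P.simplices n) := TopologicalSpace.induced (P.orbitPoint p) inferInstance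
  have di : IsDenseInducing (P.orbitPoint p : P.simplices n → P.transversal p n) :=
    ⟨⟨rfl⟩, P.denseRange_orbitPoint p n⟩
  have hlim : ∀ Q : P.transversal p n, ∃ a,
      Filter.Tendsto c (Filter.comap (P.orbitPoint p) (nhds Q)) (nhds a) := by
    intro Q
    have := di.comap_nhds_neBot Q
    refine CompleteSpace.complete (EMetric.cauchy_iff.2 ⟨Filter.NeBot.ne inferInstance, fun ε hε => ?_⟩)
    -- An s-PE cochain within `ε / 2` of `c` is constant near `Q`, so nearby values of `c` differ by
    -- less than `ε`; completeness supplies the limit.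
    obtain ⟨c', ⟨k, hk⟩, hcc'⟩ := hc.2 (ε / 2) (ENNReal.half_pos hε.ne')
    obtain ⟨V, hV, hsame⟩ := P.exists_nhds_sameNeighborhood p k Q
    refine ⟨_, Filter.image_mem_map (Filter.preimage_mem_comap hV), ?_⟩
    rintro _ ⟨σ, hσ, rfl⟩ _ ⟨σ', hσ', rfl⟩
    have h1 : edist (c σ) (c' σ) < ε / 2 := (le_iSup (fun σ => edist (c σ) (c' σ)) σ).trans_lt hcc'
    have h2 : edist (c σ') (c' σ') < ε / 2 :=
      (le_iSup (fun σ => edist (c σ) (c' σ)) σ').trans_lt hcc'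
    rw [← hk σ σ' (hsame σ σ' hσ hσ')] at h2
    refine (edist_triangle_right _ _ (c' σ)).trans_lt ?_
    rw [← ENNReal.add_halves ε]
    exact ENNReal.add_lt_add h1 h2
  exact ⟨di.extend c, di.continuous_extend hlim, funext fun σ => di.extend_eq' hlim σ⟩

end WeakPE

end SimplicialTiling

/-- A homomorphism that maps a subgroup `T` bijectively onto a subgroup `S` gives an isomorphism
from `S` onto `T`. -/
noncomputable def AddSubgroup.equivOfBijOn {G H : Type*} [AddCommGroup G] [AddCommGroup H]
    (ρ : G →+ H) {T : AddSubgroup G} {S : AddSubgroup H} (hρ : Set.BijOn ρ T S) : S ≃+ T :=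
  (AddEquiv.ofBijective ((ρ.comp T.subtype).codRestrict S fun f => hρ.mapsTo f.2)
    ⟨fun f g h => Subtype.ext (hρ.injOn f.2 g.2 (congrArg Subtype.val h)), fun c => by
      obtain ⟨f, hf, h⟩ := hρ.surjOn c.2
      exact ⟨⟨f, hf⟩, Subtype.ext h⟩⟩).symm

theorem AddSubgroup.equivOfBijOn_apply_eq_iff {G H : Type*} [AddCommGroup G] [AddCommGroup H]
    {ρ : G →+ H} {T : AddSubgroup G} {S : AddSubgroup H} (hρ : Set.BijOn ρ T S) {c : S} {f : T} :
    AddSubgroup.equivOfBijOn ρ hρ c = f ↔ ρ f.1 = c.1 := by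
  rw [AddSubgroup.equivOfBijOn, AddEquiv.symm_apply_eq, Subtype.ext_iff]
  exact eq_comm

namespace SimplicialTiling

variable {d : ℕ}

/-! ### The isomorphisms of complexes -/

/-- Rather than comparing neighborhoods of a simplex and its faces, stability under `d_S` is
transported from locally constant functions. -/
theorem isComplex_strongPE (A : Type*) [AddCommGroup A] (P : SimplicialTiling d)
    (p : Puncturing d) : IsComplex (P.dS A) (P.strongPE A) := by
  refine ⟨fun n c hc => ?_, fun n c _ => P.dS_dS n c⟩
  obtain ⟨f, hf, rfl⟩ := exists_orbitRestrict_eq_of_strongPE p hc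
  rw [← orbitRestrict_dPV]
  exact orbitRestrict_mem_strongPE (isLocallyConstant_dPV hf)

theorem isComplex_strongPV (A : Type*) [AddCommGroup A] (P : SimplicialTiling d)
    (p : Puncturing d) : IsComplex (P.dPV A p) (P.strongPV A p) := by
  refine ⟨fun n f hf => isLocallyConstant_dPV hf, fun n f hf =>
    eq_of_orbitRestrict_eq_of_isLocallyConstant
      (isLocallyConstant_dPV (isLocallyConstant_dPV hf)) (IsLocallyConstant.const 0) ?_⟩
  rw [orbitRestrict_dPV, orbitRestrict_dPV, dS_dS]
  rfl

/-- The isomorphism from the s-PE cochains onto the locally constant functions on `Ξⁿ`. -/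
noncomputable def strongEquiv (A : Type*) [AddCommGroup A] (P : SimplicialTiling d)
    (p : Puncturing d) (n : ℕ) : P.strongPE A n ≃+ P.strongPV A p n :=
  AddSubgroup.equivOfBijOn (P.orbitRestrict A p n)
    ⟨fun _ hf => orbitRestrict_mem_strongPE hf,
      fun _ hf _ hg h => eq_of_orbitRestrict_eq_of_isLocallyConstant hf hg h,
      fun _ hc => exists_orbitRestrict_eq_of_strongPE p hc⟩

theorem strongEquiv_apply_eq_iff {A : Type*} [AddCommGroup A] {P : SimplicialTiling d}
    {p : Puncturing d} {n : ℕ} {c : P.strongPE A n} {f : P.strongPV A p n} :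
    P.strongEquiv A p n c = f ↔ P.orbitRestrict A p n f.1 = c.1 :=
  AddSubgroup.equivOfBijOn_apply_eq_iff _

theorem orbitRestrict_strongEquiv {A : Type*} [AddCommGroup A] {P : SimplicialTiling d}
    {p : Puncturing d} {n : ℕ} (c : P.strongPE A n) :
    P.orbitRestrict A p n (P.strongEquiv A p n c).1 = c.1 :=
  strongEquiv_apply_eq_iff.1 rfl

theorem strongEquiv_dS {A : Type*} [AddCommGroup A] {P : SimplicialTiling d} {p : Puncturing d}
    {n : ℕ} (c : P.strongPE A n) (c' : P.strongPE A (n + 1)) (h : c'.1 = P.dS A n c.1) :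
    (P.strongEquiv A p (n + 1) c').1 = P.dPV A p n (P.strongEquiv A p n c).1 :=
  eq_of_orbitRestrict_eq_of_isLocallyConstant (P.strongEquiv A p (n + 1) c').2
    (isLocallyConstant_dPV (P.strongEquiv A p n c).2)
    (by rw [orbitRestrict_dPV, orbitRestrict_strongEquiv, orbitRestrict_strongEquiv, h])

theorem isComplex_weakPV {A : Type*} [AddCommGroup A] [MetricSpace A]
    [IsTopologicalAddGroup A] (P : SimplicialTiling d) (p : Puncturing d) :
    IsComplex (P.dPV A p) (P.weakPV A p) := by
  refine ⟨fun n f hf => continuous_dPV hf, fun n f hf =>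
    eq_of_orbitRestrict_eq (continuous_dPV (continuous_dPV hf)) continuous_const (g := 0) ?_⟩
  rw [orbitRestrict_dPV, orbitRestrict_dPV, dS_dS]
  rfl

section WeakPE

variable {A : Type*} [AddCommGroup A] [MetricSpace A] [CompleteSpace A] [IsTopologicalAddGroup A]

theorem isComplex_weakPE (P : SimplicialTiling d) (p : Puncturing d) :
    IsComplex (P.dS A) (P.weakPE A) := by
  refine ⟨fun n c hc => ?_, fun n c _ => P.dS_dS n c⟩
  obtain ⟨f, hf, rfl⟩ := exists_orbitRestrict_eq_of_weakPE p hc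
  rw [← orbitRestrict_dPV]
  exact orbitRestrict_mem_weakPE (continuous_dPV hf)

variable (A) in
/-- The isomorphism from the w-PE cochains onto the continuous functions on `Ξⁿ`. -/
noncomputable def weakEquiv (P : SimplicialTiling d) (p : Puncturing d) (n : ℕ) :
    P.weakPE A n ≃+ P.weakPV A p n :=
  AddSubgroup.equivOfBijOn (P.orbitRestrict A p n)
    ⟨fun _ hf => orbitRestrict_mem_weakPE hf,
      fun _ hf _ hg h => eq_of_orbitRestrict_eq hf hg h,
      fun _ hc => exists_orbitRestrict_eq_of_weakPE p hc⟩

theorem weakEquiv_apply_eq_iff {P : SimplicialTiling d} {p : Puncturing d} {n : ℕ}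
    {c : P.weakPE A n} {f : P.weakPV A p n} :
    P.weakEquiv A p n c = f ↔ P.orbitRestrict A p n f.1 = c.1 :=
  AddSubgroup.equivOfBijOn_apply_eq_iff _

theorem orbitRestrict_weakEquiv {P : SimplicialTiling d} {p : Puncturing d} {n : ℕ}
    (c : P.weakPE A n) : P.orbitRestrict A p n (P.weakEquiv A p n c).1 = c.1 :=
  weakEquiv_apply_eq_iff.1 rfl

theorem weakEquiv_dS {P : SimplicialTiling d} {p : Puncturing d} {n : ℕ} (c : P.weakPE A n)
    (c' : P.weakPE A (n + 1)) (h : c'.1 = P.dS A n c.1) :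
    (P.weakEquiv A p (n + 1) c').1 = P.dPV A p n (P.weakEquiv A p n c).1 :=
  eq_of_orbitRestrict_eq (P.weakEquiv A p (n + 1) c').2 (continuous_dPV (P.weakEquiv A p n c).2)
    (by rw [orbitRestrict_dPV, orbitRestrict_weakEquiv, orbitRestrict_weakEquiv, h])

theorem weakEquiv_strongPE {P : SimplicialTiling d} {p : Puncturing d} {n : ℕ}
    (c : P.strongPE A n) : ∃ h : c.1 ∈ P.weakPE A n,
      (P.weakEquiv A p n ⟨c.1, h⟩).1 = (P.strongEquiv A p n c).1 := by
  have hf : Continuous (P.strongEquiv A p n c).1 :=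
    IsLocallyConstant.continuous (P.strongEquiv A p n c).2
  have e := orbitRestrict_strongEquiv (p := p) c
  have h : c.1 ∈ P.weakPE A n := e ▸ orbitRestrict_mem_weakPE hf
  exact ⟨h, congrArg Subtype.val
    (weakEquiv_apply_eq_iff (c := ⟨c.1, h⟩) (f := ⟨(P.strongEquiv A p n c).1, hf⟩).2 e)⟩

end WeakPE

end SimplicialTiling

/-! ### Comparison of PE and PV cohomology -/

theorem mainTheorem2 {d : ℕ} (P : SimplicialTiling d) (p : Puncturing d)
    (A : Type*) [AddCommGroup A] :
    -- the strong versions, for an arbitrary abelian group `A`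
    IsComplex (P.dS A) (P.strongPE A) ∧ IsComplex (P.dPV A p) (P.strongPV A p) ∧
    ∃ φ : ∀ n, P.strongPE A n ≃+ P.strongPV A p n,
      (∀ n c f, φ n c = f ↔ ∀ σ, f.1 (P.orbitPoint p σ) = c.1 σ) ∧
      (∀ n (c : P.strongPE A n) (c' : P.strongPE A (n + 1)), c'.1 = P.dS A n c.1 →
        (φ (n + 1) c').1 = P.dPV A p n (φ n c).1) ∧
      (∃ Φ : ∀ n, Cohomology (P.dS A) (P.strongPE A) n ≃+
          Cohomology (P.dPV A p) (P.strongPV A p) n,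
        ∀ n c (hc : c ∈ cocycles (P.dS A) (P.strongPE A) n),
          ∃ h : (φ n ⟨c, hc.1⟩).1 ∈ cocycles (P.dPV A p) (P.strongPV A p) n,
            Φ n (cohomologyClass c hc) = cohomologyClass _ h) ∧
      -- the weak versions, if `A` carries a complete metric
      ∀ [MetricSpace A] [CompleteSpace A] [IsTopologicalAddGroup A],
        IsComplex (P.dS A) (P.weakPE A) ∧ IsComplex (P.dPV A p) (P.weakPV A p) ∧
        (∀ n c c', supEDist (φ n c).1 (φ n c').1 = supEDist c.1 c'.1) ∧
        ∃ φw : ∀ n, P.weakPE A n ≃+ P.weakPV A p n,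
          (∀ n (c : P.strongPE A n), ∃ h : c.1 ∈ P.weakPE A n, (φw n ⟨c.1, h⟩).1 = (φ n c).1) ∧
          (∀ n c f, φw n c = f ↔ ∀ σ, f.1 (P.orbitPoint p σ) = c.1 σ) ∧
          (∀ n c c', supEDist (φw n c).1 (φw n c').1 = supEDist c.1 c'.1) ∧
          (∀ n (c : P.weakPE A n) (c' : P.weakPE A (n + 1)), c'.1 = P.dS A n c.1 →
            (φw (n + 1) c').1 = P.dPV A p n (φw n c).1) ∧
          ∃ Φw : ∀ n, Cohomology (P.dS A) (P.weakPE A) n ≃+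
              Cohomology (P.dPV A p) (P.weakPV A p) n,
            ∀ n c (hc : c ∈ cocycles (P.dS A) (P.weakPE A) n),
              ∃ h : (φw n ⟨c, hc.1⟩).1 ∈ cocycles (P.dPV A p) (P.weakPV A p) n,
                Φw n (cohomologyClass c hc) = cohomologyClass _ h := by
  refine ⟨P.isComplex_strongPE A p, P.isComplex_strongPV A p, P.strongEquiv A p,
    fun n c f => SimplicialTiling.strongEquiv_apply_eq_iff.trans funext_iff,
    fun n c c' => SimplicialTiling.strongEquiv_dS c c',
    exists_cohomology_equiv (P.isComplex_strongPE A p) _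
      fun n c => SimplicialTiling.strongEquiv_dS c _ rfl, ?_⟩
  intro _ _ _
  refine ⟨P.isComplex_weakPE p, P.isComplex_weakPV p, fun n c c' => ?_, P.weakEquiv A p,
    fun n c => SimplicialTiling.weakEquiv_strongPE c,
    fun n c f => SimplicialTiling.weakEquiv_apply_eq_iff.trans funext_iff, fun n c c' => ?_,
    fun n c c' => SimplicialTiling.weakEquiv_dS c c',
    exists_cohomology_equiv (P.isComplex_weakPE p) _
      fun n c => SimplicialTiling.weakEquiv_dS c _ rfl⟩
  · rw [← SimplicialTiling.supEDist_orbitRestrict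
        (IsLocallyConstant.continuous (P.strongEquiv A p n c).2)
        (IsLocallyConstant.continuous (P.strongEquiv A p n c').2),
      SimplicialTiling.orbitRestrict_strongEquiv, SimplicialTiling.orbitRestrict_strongEquiv]
  · rw [← SimplicialTiling.supEDist_orbitRestrict (P.weakEquiv A p n c).2
        (P.weakEquiv A p n c').2,
      SimplicialTiling.orbitRestrict_weakEquiv, SimplicialTiling.orbitRestrict_weakEquiv]
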